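/- Let $m\ge 2$, let $\mathbb W$ be a complex vector space of dimension $2m$, let $\mathbb I$ be a complex vector space of dimension $1$, and let $\omega:\wedge^2\mathbb W\to\mathbb I$ be a symplectic form. Let $\mathbb H=\mathbb W\oplus\mathbb I$ be the Heisenberg group, with multiplication $(w,z)\cdot(w',z')=(w+w',z+z'+\tfrac12\omega(w,w'))$. Let $\boldsymbol\theta$ be a left-invariant 1-form on $\mathbb H$ whose kernel at the identity is $\mathbb W$, and let $\mathcal W=\mathrm{Ker}(\boldsymbol\theta)\subset T\mathbb H$. Let $S\subset\mathbb P\mathbb W$ be a Legendrian submanifold, i.e. a locally closed complex submanifold of dimension $m-1$ such that $\omega(\alpha,T_\alpha S^+)=0$ for every $\alpha\in S^+$, where $S^+\subset\mathbb W\setminus\{0\}$ is the punctured affine cone over $S$. Let $\mathcal S=S\times\mathbb H$ with projection $\mu:\mathcal S\to\mathbb H$, and let $\rho:\mathcal S\to\mathcal L^S$ be the projection to the complex manifold $\mathcal L^S=\bigsqcup_{[w]\in S}\mathbb H/\exp(\mathbb C w)$ of $S$-lines $x\cdot\exp(\mathbb C w)$, $x\in\mathbb H$, $[w]\in S$. Let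 $R\subset T\mathcal S$ be the distribution whose fibre at $([w],x)$ is $$R_{([w],x)}=\{v\in T_{([w],x)}\mathcal S:\ \mathrm d\mu(v)\in\mathcal W_x,\ \mathrm d\boldsymbol\theta(\mathrm d\mu(v),\alpha)=0\},$$ where $\alpha\in\mathcal W_x$ is the left translate of $w$. Then there is a holomorphic vector subbundle $Q\subset T\mathcal L^S$ of corank $2$ with $R_y=(\mathrm d_y\rho)^{-1}(Q_{\rho(y)})$ for all $y\in\mathcal S$. For every such $Q$, let $Q^\perp\subset T^\vee\mathcal L^S$ be its annihilator, and let $\vartheta$ be the restriction to $\mathbb PQ^\perp$ of the $\mathcal O(1)$-valued contact form $\vartheta^{\mathcal L^S}$ of $\mathbb PT^\vee\mathcal L^S$, which sends $u\in T_{[\alpha]}(\mathbb PT^\vee\mathcal L^S)$ to $\alpha(\mathrm d\varpi(u))\cdot\alpha^\vee$, where $\varpi:\mathbb PT^\vee\mathcal L^S\to\mathcal L^S$ is the projection and $\alpha^\vee\in\mathcal O(1)_{[\alpha]}=\mathrm{Hom}(\mathbb C\alpha,\mathbb C)$ satisfies $\alpha^\vee(\alpha)=1$. Write $\vartheta=\check\vartheta\otimes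 l$ near a point $[\beta]$, with $l$ a nowhere vanishing holomorphic local section of $\mathcal O(1)$ and $\check\vartheta$ a holomorphic 1-form, and put $\mathbf d_{[\beta]}\vartheta(u,v)=\mathrm d\check\vartheta(u,v)\cdot l_{[\beta]}$ for $u,v\in\mathrm{Ker}(\vartheta_{[\beta]})\subset T_{[\beta]}\mathbb PQ^\perp$; this does not depend on $l$. Then for every nonzero $\beta\in Q^\perp$, $$\dim\{v\in\mathrm{Ker}(\vartheta_{[\beta]}):\ \mathbf d_{[\beta]}\vartheta(u,v)=0\ \text{for all}\ u\in\mathrm{Ker}(\vartheta_{[\beta]})\}=m-1 .$$ -/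

import Mathlib

open scoped Manifold ContDiff Topology LinearAlgebra.Projectivization

noncomputable section

set_option linter.unusedSectionVars false

/-! ## Differential forms and tangent spaces of submanifolds in a vector space -/

section VectorSpace

variable {V : Type*} [NormedAddCommGroup V] [NormedSpace ℂ V]

/-- The exterior derivative at the point `x` of the 1-form `θ` on a complex vector space, as a
bilinear form `(a, b) ↦ dθ(a, b)`. -/
def extDerivOne (θ : V → (V →L[ℂ] ℂ)) (x : V) : V →ₗ[ℂ] V →ₗ[ℂ] ℂ :=
  LinearMap.mk₂ ℂ (fun a b => extDeriv
      (fun y => ContinuousAlternatingMap.ofSubsingleton ℂ V ℂ (0 : Fin 1) (θ y)) x ![a, b])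
    (fun a b c => (extDeriv (fun y => ContinuousAlternatingMap.ofSubsingleton ℂ V ℂ (0 : Fin 1)
      (θ y)) x).toAlternatingMap.map_vecCons_add ![c] a b)
    (fun k a c => (extDeriv (fun y => ContinuousAlternatingMap.ofSubsingleton ℂ V ℂ (0 : Fin 1)
      (θ y)) x).toAlternatingMap.map_vecCons_smul ![c] k a)
    (fun a b c => by
      have h (d : V) : Function.update ![a, b] 1 d = ![a, d] := by
        ext i; fin_cases i <;> rfl
      have h' := (extDeriv (fun y => ContinuousAlternatingMap.ofSubsingleton ℂ V ℂ (0 : Fin 1)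
        (θ y)) x).toAlternatingMap.map_update_add ![a, b] 1 b c
      rw [h, h, h] at h'
      exact h')
    (fun k a b => by
      have h (d : V) : Function.update ![a, b] 1 d = ![a, d] := by
        ext i; fin_cases i <;> rfl
      have h' := (extDeriv (fun y => ContinuousAlternatingMap.ofSubsingleton ℂ V ℂ (0 : Fin 1)
        (θ y)) x).toAlternatingMap.map_update_smul ![a, b] 1 k b
      rw [h, h] at h'
      exact h')

/-- The tangent space at `p` of a complex submanifold `Z` of a vector space: it is spanned by the
velocities at time `0` of the holomorphic curve germs in `Z` through `p`. -/
def holTangent (Z : Set V) (p : V) : Submodule ℂ V :=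
  Submodule.span ℂ {v | ∃ c : ℂ → V, AnalyticAt ℂ c 0 ∧ c 0 = p ∧ (∀ᶠ t in 𝓝 0, c t ∈ Z) ∧
    deriv c 0 = v}

/-- The kernel `Ker(θ|_Z)` at `p`, inside the tangent space of the submanifold `Z`. -/
def formKer (Z : Set V) (θ : V → (V →L[ℂ] ℂ)) (p : V) : Submodule ℂ V :=
  holTangent Z p ⊓ LinearMap.ker (θ p).toLinearMap

/-- The null space of the restriction of `d(θ|_Z)` to the kernel of `θ|_Z` at `p`: all `v` in
`Ker(θ|_Z)` with `dθ(v, u) = 0` for every `u` in `Ker(θ|_Z)`. -/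
def formNull (Z : Set V) (θ : V → (V →L[ℂ] ℂ)) (p : V) : Submodule ℂ V where
  carrier := {v | v ∈ formKer Z θ p ∧ ∀ u ∈ formKer Z θ p, extDerivOne θ p v u = 0}
  zero_mem' := ⟨zero_mem _, fun u _ => by simp⟩
  add_mem' := fun ha hb => ⟨add_mem ha.1 hb.1, fun u hu => by simp [ha.2 u hu, hb.2 u hu]⟩
  smul_mem' := fun k _ ha => ⟨Submodule.smul_mem _ k ha.1, fun u hu => by simp [ha.2 u hu]⟩

end VectorSpace

/-! ## Distributions and projectivized cotangent bundles of complex manifolds -/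

section Manifold

variable {E : Type*} [NormedAddCommGroup E] [NormedSpace ℂ E]
variable {M : Type*} [TopologicalSpace M] [ChartedSpace E M]

/-- `D` is a distribution of corank `c` on the complex manifold `M`: a holomorphic vector subbundle
of the tangent bundle, i.e. spanned near every point by a holomorphic frame. -/
def IsDistributionOfCorank [IsManifold 𝓘(ℂ, E) ω M] (c : ℕ)
    (D : ∀ x : M, Submodule ℂ (TangentSpace 𝓘(ℂ, E) x)) : Prop :=
  ∃ r : ℕ, r + c = Module.finrank ℂ E ∧
    ∀ x₀ : M, ∃ U : Set M, IsOpen U ∧ x₀ ∈ U ∧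
      ∃ X : Fin r → ∀ x : M, TangentSpace 𝓘(ℂ, E) x,
        (∀ i, ContMDiffOn 𝓘(ℂ, E) 𝓘(ℂ, E).tangent ω
          (fun x => (⟨x, X i x⟩ : TangentBundle 𝓘(ℂ, E) M)) U) ∧
        ∀ x ∈ U, LinearIndependent ℂ (fun i => X i x) ∧
          Submodule.span ℂ (Set.range fun i => X i x) = D x

variable (E M) in
/-- The points of the projectivized cotangent bundle of `M`. -/
abbrev ProjCotangent : Type _ := Σ x : M, ℙ ℂ (TangentSpace 𝓘(ℂ, E) x →L[ℂ] ℂ)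

/-- The point `[β]` of the projectivized cotangent bundle. -/
def ProjCotangent.ofCovector (x : M) (β : TangentSpace 𝓘(ℂ, E) x →L[ℂ] ℂ) (hβ : β ≠ 0) :
    ProjCotangent E M := ⟨x, Projectivization.mk ℂ β hβ⟩

/-- The projectivization of the annihilator `D^⊥ ⊂ T^∨ M` of a distribution `D`. -/
def projAnnihilator (D : ∀ x : M, Submodule ℂ (TangentSpace 𝓘(ℂ, E) x)) :
    Set (ProjCotangent E M) :=
  {q | ∀ α ∈ q.2.submodule, ∀ v ∈ D q.1, α v = 0}

/-- The covectors `α` at `x`, as covectors `α ∘ (d_x φ)⁻¹` in the coordinates of the chart `φ` of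
`M` around `x₀`. -/
def chartCovector (x₀ : M) (x : M) : (TangentSpace 𝓘(ℂ, E) x →L[ℂ] ℂ) →ₗ[ℂ] (E →L[ℂ] ℂ) where
  toFun α := α ∘L (mfderiv 𝓘(ℂ, E) 𝓘(ℂ, E) (chartAt E x₀) x).inverse
  map_add' _ _ := rfl
  map_smul' _ _ := rfl

/-- The domain of the chart `affineCoord x₀ e` below. -/
def affineDomain (x₀ : M) (e : E) : Set (ProjCotangent E M) :=
  {q | q.1 ∈ (chartAt E x₀).source ∧ chartCovector x₀ q.1 q.2.rep e ≠ 0}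

/-- Every point of the projectivized cotangent bundle lies in the domain of an affine chart. -/
theorem exists_affineDomain [IsManifold 𝓘(ℂ, E) ω M] (q : ProjCotangent E M) :
    ∃ e, q ∈ affineDomain q.1 e := by
  have hinv : (mfderiv 𝓘(ℂ, E) 𝓘(ℂ, E) (chartAt E q.1) q.1).IsInvertible := by
    have := isInvertible_mfderiv_extChartAt (I := 𝓘(ℂ, E)) (x := q.1) (mem_extChartAt_source q.1)
    have h : (extChartAt 𝓘(ℂ, E) q.1 : M → E) = chartAt E q.1 := by simp [extChartAt, mfld_simps]
    rw [h] at this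
    exact this
  obtain ⟨A, hA⟩ := hinv
  obtain ⟨v, hv⟩ : ∃ v, q.2.rep v ≠ 0 := by
    by_contra! h
    exact q.2.rep_nonzero (ContinuousLinearMap.ext h)
  refine ⟨A v, mem_chart_source E _, ?_⟩
  simp only [chartCovector, LinearMap.coe_mk, AddHom.coe_mk, ← hA, ContinuousLinearMap.inverse_equiv]
  change q.2.rep (A.symm (A v)) ≠ 0
  rwa [A.symm_apply_apply]

/-- The standard affine chart of the projectivized cotangent bundle, given by the chart `φ` of `M`
around `x₀` and a vector `e`. It identifies the open subset `affineDomain x₀ e` with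
`{(y, ξ) | y ∈ φ.target, ξ e = 1} ⊂ E × E^∨`, by sending `(x, [α])` to `φ x` and the unique
multiple `ξ` of `α ∘ (d_x φ)⁻¹` with `ξ e = 1`. -/
def affineCoord (x₀ : M) (e : E) (q : ProjCotangent E M) : E × (E →L[ℂ] ℂ) :=
  (chartAt E x₀ q.1,
    (chartCovector x₀ q.1 q.2.rep e)⁻¹ • chartCovector x₀ q.1 q.2.rep)

/-- The fibre at `q = [α]` of the line bundle `O(1)`, which is `Hom(ℂ α, ℂ)`. -/
abbrev FibreO1 (q : ProjCotangent E M) : Type _ := q.2.submodule →ₗ[ℂ] ℂ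

/-- The `O(1)`-valued contact form on the projectivized cotangent bundle at `q = [α]`, on the
tangent vector with components `(v, η)` in the chart `affineCoord x₀ e`. This tangent vector
projects to `(d_x φ)⁻¹ v ∈ T_x M`, and the value is the functional on `ℂ α` sending `γ` to
`γ ((d_x φ)⁻¹ v)`, which is `α ((d_x φ)⁻¹ v) • α^∨`. -/
def contactFormO1 (x₀ : M) (q : ProjCotangent E M) (u : E × (E →L[ℂ] ℂ)) : FibreO1 q where
  toFun γ := chartCovector x₀ q.1 γ u.1
  map_add' _ _ := by simp
  map_smul' _ _ := by simp

/-- The holomorphic section of `O(1)` over `affineDomain x₀ e` whose value at `[α]` is the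
functional on `ℂ α` given by evaluation at `(d_x φ)⁻¹ e`. -/
def frameO1 (x₀ : M) (e : E) (q : ProjCotangent E M) : FibreO1 q where
  toFun γ := chartCovector x₀ q.1 γ e
  map_add' _ _ := by simp
  map_smul' _ _ := by simp

/-- The 1-form `(v, η) ↦ ξ v` at `(y, ξ)`, on `E × E^∨`. By `contactFormO1_eq` below, its
restriction to `{ξ e = 1}` is the 1-form `ϑ'` in the expression `ϑ = ϑ' ⊗ frameO1 x₀ e` of the
`O(1)`-valued contact form `ϑ`. -/
def tautForm (p : E × (E →L[ℂ] ℂ)) : E × (E →L[ℂ] ℂ) →L[ℂ] ℂ :=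
  p.2 ∘L ContinuousLinearMap.fst ℂ E (E →L[ℂ] ℂ)

theorem frameO1_ne_zero (x₀ : M) (e : E) (q : ProjCotangent E M) (hq : q ∈ affineDomain x₀ e) :
    frameO1 x₀ e q ≠ 0 := by
  intro h
  have hmem : q.2.rep ∈ q.2.submodule := by
    rw [Projectivization.submodule_eq]; exact Submodule.mem_span_singleton_self _
  exact hq.2 (LinearMap.congr_fun h ⟨q.2.rep, hmem⟩)

theorem contactFormO1_eq (x₀ : M) (e : E) (q : ProjCotangent E M) (hq : q ∈ affineDomain x₀ e)
    (u : E × (E →L[ℂ] ℂ)) :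
    contactFormO1 x₀ q u = tautForm (affineCoord x₀ e q) u • frameO1 x₀ e q := by
  ext ⟨γ, hγ⟩
  rw [Projectivization.submodule_eq] at hγ
  obtain ⟨c, rfl⟩ := Submodule.mem_span_singleton.1 hγ
  have h := hq.2
  simp only [contactFormO1, frameO1, tautForm, affineCoord, LinearMap.smul_apply,
    LinearMap.coe_mk, AddHom.coe_mk, ContinuousLinearMap.comp_apply, smul_eq_mul,
    ContinuousLinearMap.coe_fst', _root_.smul_apply] at h ⊢
  simp only [map_smul, _root_.smul_apply, smul_eq_mul]
  field_simp

/-- For the `O(1)`-valued contact form `ϑ` of the projectivized cotangent bundle of `M` and a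
distribution `D` on `M`, the null space at `q` of the twisted differential of `ϑ|_{ℙ D^⊥}`,
expressed in the chart `affineCoord x₀ e` and computed with the section `frameO1 x₀ e` of
`O(1)`. -/
def twistedNull (D : ∀ x : M, Submodule ℂ (TangentSpace 𝓘(ℂ, E) x)) (x₀ : M) (e : E)
    (q : ProjCotangent E M) : Submodule ℂ (E × (E →L[ℂ] ℂ)) :=
  formNull (affineCoord x₀ e '' (projAnnihilator D ∩ affineDomain x₀ e)) tautForm
    (affineCoord x₀ e q)

end Manifold

/-! ## The Heisenberg group -/

section Heisenberg

variable {W I : Type*} [NormedAddCommGroup W] [NormedSpace ℂ W] [NormedAddCommGroup I]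
  [NormedSpace ℂ I]

variable (W I) in
/-- Symplectic forms on `W` with values in `I`. -/
structure SymplecticForm where
  /-- the bilinear form -/
  form : W →L[ℂ] W →L[ℂ] I
  alternating : ∀ w, form w w = 0
  nondegenerate : ∀ w, (∀ w', form w w' = 0) → w = 0

namespace SymplecticForm

variable (Ω : SymplecticForm W I)

/-- The multiplication of the Heisenberg group, whose underlying space is `W × I`. The identity
element is `0` and the inverse of `x` is `-x`. -/
def mul (x y : W × I) : W × I := (x.1 + y.1, x.2 + y.2 + (1 / 2 : ℂ) • Ω.form x.1 y.1)

theorem form_swap (a b : W) : Ω.form a b = -Ω.form b a := by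
  have h := Ω.alternating (a + b)
  simp only [map_add, _root_.add_apply, Ω.alternating, zero_add, add_zero] at h
  exact eq_neg_of_add_eq_zero_left (by rwa [add_comm])

theorem neg_mul_self (x : W × I) : Ω.mul (-x) x = 0 := by
  simp [mul, Ω.alternating, Prod.ext_iff]

theorem mul_assoc' (x y z : W × I) : Ω.mul (Ω.mul x y) z = Ω.mul x (Ω.mul y z) := by
  ext
  · simp [mul, add_assoc]
  · simp only [mul, map_add, _root_.add_apply, smul_add]
    abel

/-- The differential at the identity of the left translation by `x`. -/
def leftDeriv (x : W × I) : W × I →L[ℂ] W × I := fderiv ℂ (fun y => Ω.mul x y) 0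

/-- The left-invariant subbundle of the tangent bundle of the Heisenberg group determined by
the subspace `W` of the tangent space at the identity. -/
def leftW (x : W × I) : Submodule ℂ (W × I) :=
  (Submodule.prod ⊤ ⊥ : Submodule ℂ (W × I)).map (Ω.leftDeriv x).toLinearMap

/-- The left-invariant 1-form on the Heisenberg group with value `θ₀` at the identity. -/
def leftForm (θ₀ : W × I →L[ℂ] ℂ) (x : W × I) : W × I →L[ℂ] ℂ :=
  θ₀ ∘L fderiv ℂ (fun y => Ω.mul (-x) y) x

end SymplecticForm

/-! ## Submanifolds of projective space -/

/-- The quotient topology on the projectivization. -/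
instance instTopologicalSpaceProjectivization : TopologicalSpace (ℙ ℂ W) :=
  inferInstanceAs (TopologicalSpace (Quotient (projectivizationSetoid ℂ W)))

/-- `S` is a locally closed complex submanifold of `ℙ W`: the subspace `S`, with the given atlas,
is a complex manifold and its inclusion in `ℙ W` is a holomorphic immersion. The latter is stated by
means of local lifts `f` to `W \ {0}`: since `T_[w] ℙ W = Hom(ℂ w, W / ℂ w)`, the inclusion
is immersive at `s = [w]` if and only if the composition of `d f` with `W → W / ℂ w` is injective
at `s`. -/
class IsComplexSubmanifold (E : Type*) [NormedAddCommGroup E] [NormedSpace ℂ E]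
    (S : Set (ℙ ℂ W)) [ChartedSpace E S] : Prop extends IsManifold 𝓘(ℂ, E) ω S where
  exists_lift : ∀ s : S, ∃ f : S → W, ContMDiffAt 𝓘(ℂ, E) 𝓘(ℂ, W) ω f s ∧
    (∀ᶠ s' in 𝓝 s, f s' ≠ 0 ∧ f s' ∈ (s' : ℙ ℂ W).submodule) ∧
    ∀ v : TangentSpace 𝓘(ℂ, E) s,
      (mfderiv 𝓘(ℂ, E) 𝓘(ℂ, W) f s v : W) ∈ (s : ℙ ℂ W).submodule → v = 0

/-- The affine cone over `S` with the zero vector removed. -/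
def puncturedCone (S : Set (ℙ ℂ W)) : Set W := {w | ∃ h : w ≠ 0, Projectivization.mk ℂ w h ∈ S}

/-- The condition `Ω(α, T_α S⁺) = 0` for all `α ∈ S⁺`, where `S⁺` is the punctured cone
over `S`. -/
def IsLegendrian (Ω : SymplecticForm W I) (S : Set (ℙ ℂ W)) : Prop :=
  ∀ α ∈ puncturedCone S, ∀ v ∈ holTangent (puncturedCone S) α, Ω.form α v = 0

/-! ## The space of lines with directions in `S` -/

section Lines

variable (Ω : SymplecticForm W I) (S : Set (ℙ ℂ W))

/-- Points `(s, x)` and `(s', y)` of `S × (W × I)` give the same line on the Heisenberg group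
if `s = s'` and `y` lies in the coset of `x` by the subgroup `exp(ℂ w)`, where `s = [w]`. -/
def lineSetoid : Setoid (S × (W × I)) where
  r p q := p.1 = q.1 ∧ ∃ w ∈ (p.1 : ℙ ℂ W).submodule, q.2 = Ω.mul p.2 (w, 0)
  iseqv :=
    { refl := fun p => ⟨rfl, 0, zero_mem _, by simp [SymplecticForm.mul]⟩
      symm := by
        rintro ⟨s, x⟩ ⟨s', y⟩ ⟨h, w, hw, h'⟩
        obtain rfl : s = s' := h
        obtain rfl : y = Ω.mul x (w, 0) := h'
        refine ⟨rfl, -w, neg_mem hw, ?_⟩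
        simp [SymplecticForm.mul, Ω.alternating]
      trans := by
        rintro ⟨s, x⟩ ⟨s', y⟩ ⟨s'', z⟩ ⟨h, w, hw, h'⟩ ⟨h1, w1, hw1, h1'⟩
        obtain rfl : s = s' := h
        obtain rfl : s = s'' := h1
        obtain rfl : y = Ω.mul x (w, 0) := h'
        refine ⟨rfl, w + w1, add_mem hw hw1, ?_⟩
        have h0 : Ω.form w w1 = 0 := by
          rw [Projectivization.submodule_eq] at hw hw1
          obtain ⟨a, rfl⟩ := Submodule.mem_span_singleton.1 hw
          obtain ⟨b, rfl⟩ := Submodule.mem_span_singleton.1 hw1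
          simp [Ω.alternating]
        obtain rfl : z = _ := h1'
        ext
        · simp [SymplecticForm.mul, add_assoc]
        · simp [SymplecticForm.mul, h0, add_assoc] }

/-- The space of `S`-lines on the Heisenberg group `H`: the union over `s = [w] ∈ S` of the coset
spaces `H / exp(ℂ w)`, as a quotient of `S × H`. The manifold `S × H` is the space of pairs of an
`S`-line and a point on it; it is identified by left translation with the bundle on `H` of the
tangent directions of `S`-lines. -/
def SLine : Type _ := Quotient (lineSetoid Ω S)

instance : TopologicalSpace (SLine Ω S) :=
  inferInstanceAs (TopologicalSpace (Quotient (lineSetoid Ω S)))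

namespace SLine

/-- The line `x · exp(ℂ w)` for `s = [w]`. -/
def proj (p : S × (W × I)) : SLine Ω S := Quotient.mk (lineSetoid Ω S) p

/-- The direction of an `S`-line. -/
def dir : SLine Ω S → S := Quotient.lift (s := lineSetoid Ω S) Prod.fst fun _ _ h => h.1

@[simp] theorem dir_proj (p : S × (W × I)) : dir Ω S (proj Ω S p) = p.1 := rfl

theorem isQuotientMap_proj : Topology.IsQuotientMap (proj Ω S) := isQuotientMap_quotient_mk'

theorem continuous_dir : Continuous (dir Ω S) :=
  (isQuotientMap_proj Ω S).continuous_iff.2 continuous_fst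

end SLine

end Lines

end Heisenberg

/-! ### The complex manifold structure of the space of lines -/

section Charts

variable {W I : Type*} [NormedAddCommGroup W] [NormedSpace ℂ W] [FiniteDimensional ℂ W]
  [NormedAddCommGroup I] [NormedSpace ℂ I]

variable (W) in
/-- The model of hyperplanes of `W`. -/
abbrev HypModel : Type := EuclideanSpace ℂ (Fin (Module.finrank ℂ W - 1))

/-- The representative `w` of the point `p = [w]` such that the first coordinate of `T w` is `1`
(if there is one). -/
def normRep (T : W ≃L[ℂ] ℂ × HypModel W) (p : ℙ ℂ W) : W := (T p.rep).1⁻¹ • p.rep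

/-- The points `[w]` such that the first coordinate of `T w` is nonzero. -/
def affineSet (T : W ≃L[ℂ] ℂ × HypModel W) : Set (ℙ ℂ W) := {p | (T p.rep).1 ≠ 0}

theorem rep_mk (w : W) (hw : w ≠ 0) :
    ∃ a : ℂ, a ≠ 0 ∧ (Projectivization.mk ℂ w hw).rep = a • w := by
  obtain ⟨a, ha⟩ := Projectivization.exists_smul_eq_mk_rep ℂ w hw
  exact ⟨a, a.ne_zero, ha.symm⟩

theorem mk_mem_affineSet (T : W ≃L[ℂ] ℂ × HypModel W) (w : W) (hw : w ≠ 0) :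
    Projectivization.mk ℂ w hw ∈ affineSet T ↔ (T w).1 ≠ 0 := by
  obtain ⟨a, ha, h⟩ := rep_mk w hw
  simp [affineSet, h, ha]

theorem normRep_mk (T : W ≃L[ℂ] ℂ × HypModel W) (w : W) (hw : w ≠ 0) :
    normRep T (Projectivization.mk ℂ w hw) = (T w).1⁻¹ • w := by
  obtain ⟨a, ha, h⟩ := rep_mk w hw
  rw [normRep, h, map_smul, Prod.smul_fst, smul_eq_mul, smul_smul, mul_inv]
  congr 1
  field_simp

theorem eq_mk_of_mem (p : ℙ ℂ W) (w : W) (hw : w ≠ 0)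
    (h : w ∈ p.submodule) : p = Projectivization.mk ℂ w hw := by
  rw [Projectivization.submodule_eq] at h
  obtain ⟨a, rfl⟩ := Submodule.mem_span_singleton.1 h
  conv_lhs => rw [← p.mk_rep]
  rw [Projectivization.mk_eq_mk_iff']
  have ha : a ≠ 0 := by rintro rfl; simp at hw
  refine ⟨a⁻¹, ?_⟩
  rw [smul_smul, inv_mul_cancel₀ ha, one_smul]

theorem isQuotientMap_mk' :
    Topology.IsQuotientMap (Projectivization.mk' ℂ : {w : W // w ≠ 0} → ℙ ℂ W) :=
  isQuotientMap_quotient_mk'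

theorem isOpen_affineSet (T : W ≃L[ℂ] ℂ × HypModel W) : IsOpen (affineSet T) := by
  rw [← isQuotientMap_mk'.isOpen_preimage]
  have h : (Projectivization.mk' ℂ : {w : W // w ≠ 0} → ℙ ℂ W) ⁻¹' affineSet T
      = {w | (T w.1).1 ≠ 0} := by
    ext ⟨w, hw⟩
    exact mk_mem_affineSet T w hw
  rw [h]
  exact isOpen_ne_fun (by fun_prop) continuous_const

theorem continuousOn_normRep (T : W ≃L[ℂ] ℂ × HypModel W) :
    ContinuousOn (normRep T) (affineSet T) := by
  rw [isQuotientMap_mk'.continuousOn_isOpen_iff (isOpen_affineSet T)]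
  have h : ∀ w : {w : W // w ≠ 0}, (normRep T ∘ Projectivization.mk' ℂ) w
      = (T w.1).1⁻¹ • w.1 := fun w => normRep_mk T w.1 w.2
  refine ContinuousOn.congr ?_ fun w _ => h w
  refine ContinuousOn.smul (ContinuousOn.inv₀ (by fun_prop) ?_) (by fun_prop)
  rintro ⟨w, hw⟩ h'
  exact (mk_mem_affineSet T w hw).1 h'

theorem normRep_mem (T : W ≃L[ℂ] ℂ × HypModel W) (p : ℙ ℂ W) : normRep T p ∈ p.submodule := by
  rw [Projectivization.submodule_eq]
  exact Submodule.mem_span_singleton.2 ⟨_, rfl⟩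

theorem fst_normRep (T : W ≃L[ℂ] ℂ × HypModel W) (p : ℙ ℂ W) (hp : p ∈ affineSet T) :
    (T (normRep T p)).1 = 1 := by
  have : (T p.rep).1 ≠ 0 := hp
  simp [normRep, this]

theorem eq_smul_normRep (T : W ≃L[ℂ] ℂ × HypModel W) (p : ℙ ℂ W) (hp : p ∈ affineSet T) (w : W)
    (hw : w ∈ p.submodule) : w = (T w).1 • normRep T p := by
  rw [Projectivization.submodule_eq] at hw
  obtain ⟨a, rfl⟩ := Submodule.mem_span_singleton.1 hw
  have : (T p.rep).1 ≠ 0 := hp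
  simp [normRep, smul_smul, this]

theorem exists_affineSet (p : ℙ ℂ W) : ∃ T : W ≃L[ℂ] ℂ × HypModel W, p ∈ affineSet T := by
  have hp := p.rep_nonzero
  have hpos : 0 < Module.finrank ℂ W := by
    have : Nontrivial W := ⟨⟨_, _, hp⟩⟩
    exact Module.finrank_pos
  obtain ⟨T₀⟩ : Nonempty (W ≃L[ℂ] ℂ × HypModel W) := by
    refine FiniteDimensional.nonempty_continuousLinearEquiv_of_finrank_eq ?_
    simp only [Module.finrank_prod, Module.finrank_self, finrank_euclideanSpace, Fintype.card_fin]
    omega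
  obtain ⟨A, hA⟩ := SeparatingDual.exists_continuousLinearEquiv_apply_eq (R := ℂ) (x := p.rep)
    (y := T₀.symm (1, 0)) hp (by simp)
  exact ⟨A.trans T₀, by simp [affineSet, hA]⟩

section

variable {E : Type*} [NormedAddCommGroup E] [NormedSpace ℂ E]
variable (Ω : SymplecticForm W I) (S : Set (ℙ ℂ W)) [ChartedSpace E S]

/-- For a line with direction `[w]`, `w = normRep T [w]`, through the point `(u, z)`: the
coordinates of `[w]` and of the point of the line `(u, z) · exp(ℂ w)` at which the first
coordinate of `T` vanishes. -/
def lineCoord (φ : OpenPartialHomeomorph S E) (T : W ≃L[ℂ] ℂ × HypModel W) (p : S × (W × I)) :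
    E × (HypModel W × I) :=
  let y := Ω.mul p.2 (-(T p.2.1).1 • normRep T p.1, 0)
  (φ p.1, (T y.1).2, y.2)

theorem lineCoord_eq (φ : OpenPartialHomeomorph S E) (T : W ≃L[ℂ] ℂ × HypModel W)
    (p q : S × (W × I)) (hp : (p.1 : ℙ ℂ W) ∈ affineSet T) (h : lineSetoid Ω S p q) :
    lineCoord Ω S φ T p = lineCoord Ω S φ T q := by
  obtain ⟨s, u, z⟩ := p
  obtain ⟨s', y⟩ := q
  obtain ⟨h1, w, hw, h2⟩ := h
  obtain rfl : s = s' := h1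
  obtain rfl : y = _ := h2
  have hw' := eq_smul_normRep T _ hp w hw
  have hf := fst_normRep T _ hp
  generalize (T w).1 = t at hw'
  subst hw'
  simp only at hf
  simp [lineCoord, SymplecticForm.mul, hf, Ω.alternating, Prod.ext_iff]
  constructor
  · module
  · module

theorem lineCoord_out (φ : OpenPartialHomeomorph S E) (T : W ≃L[ℂ] ℂ × HypModel W)
    (p : S × (W × I)) (hp : (p.1 : ℙ ℂ W) ∈ affineSet T) :
    lineCoord Ω S φ T (Quotient.out (s := lineSetoid Ω S) (SLine.proj Ω S p)) =
      lineCoord Ω S φ T p :=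
  (lineCoord_eq Ω S φ T p _ hp
    ((lineSetoid Ω S).symm (Quotient.mk_out (s := lineSetoid Ω S) p))).symm

/-- The inverse of the chart `lineChart`. -/
def lineParam (φ : OpenPartialHomeomorph S E) (T : W ≃L[ℂ] ℂ × HypModel W)
    (a : E × (HypModel W × I)) : SLine Ω S :=
  SLine.proj Ω S (φ.symm a.1, (T.symm (0, a.2.1), a.2.2))

/-- The open set of points of `S` on which both `φ` and the affine coordinates are defined. -/
def lineBase (φ : OpenPartialHomeomorph S E) (T : W ≃L[ℂ] ℂ × HypModel W) : Set S :=
  φ.source ∩ Subtype.val ⁻¹' affineSet T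

theorem isOpen_lineBase (φ : OpenPartialHomeomorph S E) (T : W ≃L[ℂ] ℂ × HypModel W) :
    IsOpen (lineBase S φ T) :=
  φ.open_source.inter ((isOpen_affineSet T).preimage continuous_subtype_val)

/-- The chart of the space of `S`-lines determined by a chart `φ` of `S` and linear coordinates `T`
of `W`. -/
def lineChart (φ : OpenPartialHomeomorph S E) (T : W ≃L[ℂ] ℂ × HypModel W) :
    OpenPartialHomeomorph (SLine Ω S) (E × (HypModel W × I)) where
  toFun ℓ := lineCoord Ω S φ T (Quotient.out (s := lineSetoid Ω S) ℓ)
  invFun := lineParam Ω S φ T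
  source := SLine.dir Ω S ⁻¹' lineBase S φ T
  target := {a | a.1 ∈ φ.target ∩ φ.symm ⁻¹' lineBase S φ T}
  map_source' := by
    intro ℓ hℓ
    induction ℓ using Quotient.inductionOn with | _ p
    have hp : p.1 ∈ lineBase S φ T := hℓ
    rw [show Quotient.mk (lineSetoid Ω S) p = SLine.proj Ω S p from rfl,
      lineCoord_out Ω S φ T p hp.2]
    refine ⟨φ.map_source hp.1, ?_⟩
    simpa [lineCoord, φ.left_inv hp.1] using hp
  map_target' := by
    rintro a ⟨h1, h2⟩
    exact h2
  left_inv' := by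
    intro ℓ hℓ
    induction ℓ using Quotient.inductionOn with | _ p
    have hp : p.1 ∈ lineBase S φ T := hℓ
    rw [show Quotient.mk (lineSetoid Ω S) p = SLine.proj Ω S p from rfl,
      lineCoord_out Ω S φ T p hp.2]
    symm
    refine Quotient.sound (s := lineSetoid Ω S) ⟨?_, -(T p.2.1).1 • normRep T p.1,
      Submodule.smul_mem _ _ (normRep_mem T _), ?_⟩
    · simp [lineCoord, φ.left_inv hp.1]
    · have hf := fst_normRep T _ hp.2
      have h0 : T.symm (0, (T (Ω.mul p.2 (-(T p.2.1).1 • normRep T p.1, 0)).1).2)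
          = (Ω.mul p.2 (-(T p.2.1).1 • normRep T p.1, 0)).1 := by
        rw [ContinuousLinearEquiv.symm_apply_eq]
        ext1
        · simp [SymplecticForm.mul, hf]
        · rfl
      ext1
      · exact h0
      · rfl
  right_inv' := by
    rintro a ⟨h1, h2⟩
    rw [lineParam, lineCoord_out Ω S φ T (φ.symm a.1, (T.symm (0, a.2.1), a.2.2)) h2.2]
    simp [lineCoord, SymplecticForm.mul, φ.right_inv h1]
  open_source := (isOpen_lineBase S φ T).preimage (SLine.continuous_dir Ω S)
  open_target := (φ.symm.isOpen_inter_preimage (isOpen_lineBase S φ T)).preimage continuous_fst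
  continuousOn_toFun := by
    rw [(SLine.isQuotientMap_proj Ω S).continuousOn_isOpen_iff
      ((isOpen_lineBase S φ T).preimage (SLine.continuous_dir Ω S))]
    have hn : ContinuousOn (fun p : S × (W × I) => normRep T p.1)
        (SLine.proj Ω S ⁻¹' (SLine.dir Ω S ⁻¹' lineBase S φ T)) :=
      (continuousOn_normRep T).comp (by fun_prop) fun p hp => hp.2
    have hφ : ContinuousOn (fun p : S × (W × I) => φ p.1)
        (SLine.proj Ω S ⁻¹' (SLine.dir Ω S ⁻¹' lineBase S φ T)) :=
      φ.continuousOn.comp (by fun_prop) fun p hp => hp.1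
    refine ContinuousOn.congr (f := lineCoord Ω S φ T) ?_
      fun p hp => lineCoord_out Ω S φ T p hp.2
    refine hφ.prodMk (ContinuousOn.prodMk ?_ ?_)
    · simp only [SymplecticForm.mul]
      fun_prop
    · simp only [SymplecticForm.mul]
      fun_prop
  continuousOn_invFun := by
    refine (SLine.isQuotientMap_proj Ω S).continuous.comp_continuousOn ?_
    have h : ContinuousOn (fun a : E × (HypModel W × I) => φ.symm a.1)
        {a | a.1 ∈ φ.target ∩ φ.symm ⁻¹' lineBase S φ T} :=
      φ.symm.continuousOn.comp (by fun_prop) fun a ha => ha.1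
    fun_prop

/-- The atlas of the space of `S`-lines. -/
instance instChartedSpaceSLine : ChartedSpace (E × (HypModel W × I)) (SLine Ω S) where
  atlas := {c | ∃ (s : S) (T : W ≃L[ℂ] ℂ × HypModel W), c = lineChart Ω S (chartAt E s) T}
  chartAt ℓ := lineChart Ω S (chartAt E (SLine.dir Ω S ℓ))
    (exists_affineSet (SLine.dir Ω S ℓ : ℙ ℂ W)).choose
  mem_chart_source _ := ⟨mem_chart_source E _, (exists_affineSet _).choose_spec⟩
  chart_mem_atlas _ := ⟨_, _, rfl⟩

theorem contMDiffAt_normRep [IsComplexSubmanifold E S] (T : W ≃L[ℂ] ℂ × HypModel W) (s : S)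
    (hs : (s : ℙ ℂ W) ∈ affineSet T) :
    ContMDiffAt 𝓘(ℂ, E) 𝓘(ℂ, W) ω (fun s' : S => normRep T s') s := by
  obtain ⟨f, hf, hf', -⟩ := IsComplexSubmanifold.exists_lift (E := E) s
  have h : ∀ᶠ s' : S in 𝓝 s, normRep T (s' : ℙ ℂ W) = (T (f s')).1⁻¹ • f s' := by
    filter_upwards [hf'] with s' hs'
    rw [eq_mk_of_mem _ _ hs'.1 hs'.2, normRep_mk]
  have h0 : (T (f s)).1 ≠ 0 := by
    have h1 := hf'.self_of_nhds
    rwa [eq_mk_of_mem _ _ h1.1 h1.2, mk_mem_affineSet] at hs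
  refine ContMDiffAt.congr_of_eventuallyEq ?_ h
  have hg : ContDiffAt ℂ ω (fun w : W => (T w).1⁻¹ • w) (f s) :=
    ContDiffAt.smul (ContDiffAt.inv (by fun_prop) h0) (by fun_prop)
  exact hg.contMDiffAt.comp s hf

instance instIsManifoldSLine [IsComplexSubmanifold E S] :
    IsManifold 𝓘(ℂ, E × (HypModel W × I)) ω (SLine Ω S) := by
  refine isManifold_of_contDiffOn _ _ _ ?_
  rintro _ _ ⟨s, T, rfl⟩ ⟨s', T', rfl⟩
  simp only [modelWithCornersSelf_coe, modelWithCornersSelf_coe_symm, Set.preimage_id,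
    Set.range_id, Set.inter_univ, Function.comp_id, Function.id_comp]
  intro a ha
  rw [OpenPartialHomeomorph.trans_source] at ha
  obtain ⟨⟨ha1, ha2⟩, ha3⟩ := ha
  apply ContDiffAt.contDiffWithinAt
  set φ := chartAt E s
  set φ' := chartAt E s'
  have ha3' : φ.symm a.1 ∈ lineBase S φ' T' := ha3
  have hsymm : ContMDiffAt 𝓘(ℂ, E) 𝓘(ℂ, E) ω φ.symm a.1 :=
    (contMDiffOn_chart_symm (I := 𝓘(ℂ, E)) (n := ω) (x := s)).contMDiffAt
      (φ.open_target.mem_nhds ha1)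
  have hφ' : ContDiffAt ℂ ω (fun b => φ' (φ.symm b)) a.1 := by
    rw [← contMDiffAt_iff_contDiffAt]
    exact ((contMDiffOn_chart (I := 𝓘(ℂ, E)) (n := ω) (x := s')).contMDiffAt
      (φ'.open_source.mem_nhds ha3'.1)).comp a.1 hsymm
  have hn : ContDiffAt ℂ ω (fun b => normRep T' (φ.symm b : ℙ ℂ W)) a.1 := by
    rw [← contMDiffAt_iff_contDiffAt]
    exact (contMDiffAt_normRep S T' (φ.symm a.1) ha3'.2).comp a.1 hsymm
  have hφ2 : ContDiffAt ℂ ω (fun b : E × (HypModel W × I) => φ' (φ.symm b.1)) a :=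
    hφ'.comp a (f := Prod.fst) (by fun_prop)
  have hn2 : ContDiffAt ℂ ω
      (fun b : E × (HypModel W × I) => normRep T' (φ.symm b.1 : ℙ ℂ W)) a :=
    hn.comp a (f := Prod.fst) (by fun_prop)
  have hev : ∀ᶠ b in 𝓝 a, (lineChart Ω S φ T).symm.trans (lineChart Ω S φ' T') b
      = lineCoord Ω S φ' T' (φ.symm b.1, (T.symm (0, b.2.1), b.2.2)) := by
    have h1 : ∀ᶠ b in 𝓝 a, b.1 ∈ φ.target ∩ φ.symm ⁻¹' lineBase S φ' T' :=
      ((φ.symm.isOpen_inter_preimage (isOpen_lineBase S φ' T')).preimage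
        continuous_fst).mem_nhds ⟨ha1, ha3'⟩
    filter_upwards [h1] with b hb
    exact lineCoord_out Ω S φ' T' _ hb.2.2
  refine ContDiffAt.congr_of_eventuallyEq ?_ hev
  refine hφ2.prodMk (ContDiffAt.prodMk ?_ ?_)
  · simp only [SymplecticForm.mul]
    fun_prop
  · simp only [SymplecticForm.mul]
    fun_prop

/-- The projection from `S × H` to the space of `S`-lines is holomorphic. -/
theorem contMDiff_proj [IsComplexSubmanifold E S] :
    ContMDiff (𝓘(ℂ, E).prod 𝓘(ℂ, W × I)) 𝓘(ℂ, E × (HypModel W × I)) ω (SLine.proj Ω S) := by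
  intro p
  rw [contMDiffAt_iff_target]
  refine ⟨(SLine.isQuotientMap_proj Ω S).continuous.continuousAt, ?_⟩
  set ℓ := SLine.proj Ω S p
  have hmem := mem_chart_source (E × (HypModel W × I)) ℓ
  obtain ⟨s, T, hc⟩ : chartAt (E × (HypModel W × I)) ℓ ∈ {c | ∃ (s : S) (T : W ≃L[ℂ] ℂ × HypModel W), c = lineChart Ω S (chartAt E s) T} :=
    chart_mem_atlas _ ℓ
  rw [hc] at hmem
  have hp : p.1 ∈ lineBase S (chartAt E s) T := hmem
  have hev : ∀ᶠ q in 𝓝 p, (extChartAt 𝓘(ℂ, E × (HypModel W × I)) ℓ ∘ SLine.proj Ω S) q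
      = lineCoord Ω S (chartAt E s) T q := by
    have : ∀ᶠ q : S × (W × I) in 𝓝 p, q.1 ∈ lineBase S (chartAt E s) T :=
      ((isOpen_lineBase S _ T).preimage continuous_fst).mem_nhds hp
    filter_upwards [this] with q hq
    simp only [extChartAt, hc, Function.comp, mfld_simps]
    exact lineCoord_out Ω S _ T q hq.2
  refine ContMDiffAt.congr_of_eventuallyEq ?_ hev
  have h1 : ContMDiffAt (𝓘(ℂ, E).prod 𝓘(ℂ, W × I)) 𝓘(ℂ, E) ω (fun q : S × (W × I) => chartAt E s q.1) p :=
    ((contMDiffOn_chart (I := 𝓘(ℂ, E)) (n := ω) (x := s)).contMDiffAt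
      ((chartAt E s).open_source.mem_nhds hp.1)).comp p contMDiffAt_fst
  have h2 : ContMDiffAt (𝓘(ℂ, E).prod 𝓘(ℂ, W × I)) 𝓘(ℂ, W) ω (fun q : S × (W × I) => normRep T q.1) p :=
    (contMDiffAt_normRep S T p.1 hp.2).comp p contMDiffAt_fst
  have h3 : ContMDiffAt (𝓘(ℂ, E).prod 𝓘(ℂ, W × I)) 𝓘(ℂ, W × I) ω (fun q : S × (W × I) => q.2) p :=
    contMDiffAt_snd
  have h4 : ContDiff ℂ ω (fun r : W × (W × I) => 
    let y := Ω.mul r.2 (-(T r.2.1).1 • r.1, 0)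
    ((T y.1).2, y.2)) := by
    unfold SymplecticForm.mul
    refine ContDiff.prodMk ?_ ?_ <;> simp only <;> fun_prop
  have h5 := h4.contMDiff.contMDiffAt.comp p (h2.prodMk_space h3)
  exact h1.prodMk_space h5

/-- The distribution `R` on `S × H`, where `H` is the Heisenberg group and `θ` is its left-invariant
1-form with value `θ₀` at the identity: at `(s, x)` with `s = [w]`, it consists of the tangent
vectors whose image `a ∈ T_x H` lies in the left-invariant subbundle `W` and satisfies
`dθ(a, α) = 0`, where `α ∈ T_x H` is the left translate of `w`. -/
def distR (θ₀ : W × I →L[ℂ] ℂ) (p : S × (W × I)) :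
    Submodule ℂ (TangentSpace (𝓘(ℂ, E).prod 𝓘(ℂ, W × I)) p) :=
  (Ω.leftW p.2 ⊓ LinearMap.ker ((extDerivOne (Ω.leftForm θ₀) p.2).flip
      (Ω.leftDeriv p.2 ((p.1 : ℙ ℂ W).rep, 0)))).comap
    (mfderiv (𝓘(ℂ, E).prod 𝓘(ℂ, W × I)) 𝓘(ℂ, W × I) Prod.snd p).toLinearMap

/-- `R` is the inverse image of the distribution `Q` on the space of `S`-lines under the
differential of the projection `S × H → {S-lines}`. -/
def IsInverseImage (R : ∀ p : S × (W × I), Submodule ℂ (TangentSpace (𝓘(ℂ, E).prod 𝓘(ℂ, W × I)) p))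
    (Q : ∀ ℓ : SLine Ω S, Submodule ℂ (TangentSpace 𝓘(ℂ, E × (HypModel W × I)) ℓ)) : Prop :=
  ∀ p, R p = (Q (SLine.proj Ω S p)).comap
    (mfderiv (𝓘(ℂ, E).prod 𝓘(ℂ, W × I)) 𝓘(ℂ, E × (HypModel W × I))
      (SLine.proj Ω S) p).toLinearMap

end

end Charts

end

set_option linter.unusedSectionVars false

noncomputable section

/-! ### Exterior derivatives of 1-forms -/

section ExteriorDerivative

variable {V : Type*} [NormedAddCommGroup V] [NormedSpace ℂ V]

/-! Choose a linear form `t` on `W` and represent each direction in `S` by the vector `n(a)` with `t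
(n(a)) = 1`, where `a` is a coordinate on `S`. A line is then recorded by `a` and by its point `(h,
c)` with `t h = 0`. Let `l` be the restriction of `θ₀` to the centre and `B = l ∘ ω`. In these
coordinates `Q` is the common kernel of `α₁ = l(dc) - B(h, dh)/2` and `α₂ = B(n(a), dh)`
(`exists_hasMFDerivAt_chart_proj`). The Legendrian condition, in the form `B(n, dn) = 0`, is what
lets `R` descend: moving the base point along the line alters the pairing with `n` only by multiples
of `B(n, n)` and `B(n, dn)`. As `ρ` is a surjective submersion, `Q` is determined by `R`, so this
description holds for every admissible `Q`.

The elements of `Q^⊥` are the covectors `p α₁ + q α₂`. Testing a null vector of the twisted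
differential against the fibre directions of `ℙ Q^⊥` forces its projection to the base into `K = ker
α₁ ∩ ker α₂`. The null space then projects isomorphically onto the kernel of `p dα₁ + q dα₂` on `K`,
with `p` and `q` held constant (`finrank_formNull_annihilatorSlice`).

With `D = dn`, this 2-form is `-p B(h, h') + q (B(Dx, h') - B(Dx', h))` on tangent vectors `(x, h,
c)` and `(x', h', c')`. Vectors with `x' = 0` give `p h = q Dx`, and vectors `(x', 0, 0)` give `q
B(Dx', h) = 0`. If `p ≠ 0`, the first equation makes the kernel a graph over the `x`-space, and the
second follows from `B(D, D) = 0`, obtained by differentiating `B(n, D) = 0`. If `p = 0`, then `x =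
0` and `h` is orthogonal to the Lagrangian space `ℂ n ⊕ im D`, so `h` lies in `im D`. Either way the
kernel is a copy of the tangent space of `S`, of dimension `m - 1` (`finrank_skewNull_lineModel`).
-/

theorem extDerivOne_apply {θ : V → (V →L[ℂ] ℂ)} {x : V} (hθ : DifferentiableAt ℂ θ x) (a b : V) :
    extDerivOne θ x a b = fderiv ℂ θ x a b - fderiv ℂ θ x b a := by
  have h : DifferentiableAt ℂ
      (fun y => ContinuousAlternatingMap.ofSubsingleton ℂ V ℂ (0 : Fin 1) (θ y)) x :=
    (ContinuousAlternatingMap.ofSubsingletonLIE (𝕜 := ℂ) (E := V) (F := ℂ)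
      (0 : Fin 1)).toContinuousLinearEquiv.differentiableAt.comp x hθ
  have hd (c d : V) : fderiv ℂ (fun y => θ y d) x c = fderiv ℂ θ x c d := by
    rw [fderiv_clm_apply hθ (by fun_prop)]
    simp
  simp only [extDerivOne, LinearMap.mk₂_apply, extDeriv_apply h]
  have h0 : Fin.removeNth 0 ![a, b] = ![b] := by ext i; fin_cases i; rfl
  have h1 : Fin.removeNth 1 ![a, b] = ![a] := by ext i; fin_cases i; rfl
  simp [h0, h1, hd, sub_eq_add_neg]

end ExteriorDerivative

/-! ### The left-invariant contact form on the Heisenberg group -/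

section HeisenbergForm

variable {W I : Type*} [NormedAddCommGroup W] [NormedSpace ℂ W] [NormedAddCommGroup I]
  [NormedSpace ℂ I] (Ω : SymplecticForm W I)

theorem SymplecticForm.hasFDerivAt_mul (x y : W × I) :
    HasFDerivAt (fun y => Ω.mul x y) ((ContinuousLinearMap.fst ℂ W I).prod
      (ContinuousLinearMap.snd ℂ W I + (1 / 2 : ℂ) • (Ω.form x.1 ∘L ContinuousLinearMap.fst ℂ W I)))
      y := by
  unfold SymplecticForm.mul
  refine HasFDerivAt.prodMk (hasFDerivAt_fst.const_add _) ?_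
  exact (hasFDerivAt_snd.const_add _).add
    (((Ω.form x.1).hasFDerivAt.comp y hasFDerivAt_fst).const_smul (1 / 2 : ℂ))

theorem SymplecticForm.leftDeriv_apply (x v : W × I) :
    Ω.leftDeriv x v = (v.1, v.2 + (1 / 2 : ℂ) • Ω.form x.1 v.1) := by
  rw [SymplecticForm.leftDeriv, (Ω.hasFDerivAt_mul x 0).fderiv]
  rfl

theorem SymplecticForm.mem_leftW (x v : W × I) :
    v ∈ Ω.leftW x ↔ v.2 = (1 / 2 : ℂ) • Ω.form x.1 v.1 := by
  simp only [SymplecticForm.leftW, Submodule.mem_map, Submodule.mem_prod, Submodule.mem_top,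
    true_and, Submodule.mem_bot, ContinuousLinearMap.coe_coe, leftDeriv_apply]
  constructor
  · rintro ⟨y, hy, rfl⟩
    simp [hy]
  · intro h
    exact ⟨(v.1, 0), rfl, Prod.ext rfl (by simpa using h.symm)⟩

theorem SymplecticForm.leftForm_apply (θ₀ : W × I →L[ℂ] ℂ) (x v : W × I) :
    Ω.leftForm θ₀ x v = θ₀ (v.1, v.2 - (1 / 2 : ℂ) • Ω.form x.1 v.1) := by
  rw [SymplecticForm.leftForm, (Ω.hasFDerivAt_mul (-x) x).fderiv]
  simp [sub_eq_add_neg]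

/-- The restriction to the centre of a covector at the identity of the Heisenberg group. -/
def centralForm (θ₀ : W × I →L[ℂ] ℂ) : I →L[ℂ] ℂ := θ₀ ∘L ContinuousLinearMap.inr ℂ W I

variable {θ₀ : W × I →L[ℂ] ℂ}

theorem apply_eq_centralForm (hθ₀ : LinearMap.ker θ₀.toLinearMap = Submodule.prod ⊤ ⊥)
    (v : W × I) : θ₀ v = centralForm θ₀ v.2 := by
  have h : (v.1, (0 : I)) ∈ LinearMap.ker θ₀.toLinearMap := by
    rw [hθ₀]; simp
  have h' : θ₀ (v.1, (0 : I)) = 0 := h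
  have : v = (v.1, (0 : I)) + (0, v.2) := by simp
  rw [this, map_add, h', zero_add]
  simp [centralForm]

theorem centralForm_eq_zero (hθ₀ : LinearMap.ker θ₀.toLinearMap = Submodule.prod ⊤ ⊥)
    {z : I} : centralForm θ₀ z = 0 ↔ z = 0 := by
  refine ⟨fun h => ?_, fun h => by simp [h]⟩
  have h1 : ((0 : W), z) ∈ LinearMap.ker θ₀.toLinearMap := h
  rw [hθ₀] at h1
  exact h1.2

/-- The scalar-valued skew form obtained by composing a symplectic form with a linear form. -/
def SymplecticForm.scalar (l : I →L[ℂ] ℂ) : W →L[ℂ] W →L[ℂ] ℂ :=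
  ContinuousLinearMap.compL ℂ W I ℂ l ∘L Ω.form

@[simp] theorem SymplecticForm.scalar_apply (l : I →L[ℂ] ℂ) (a b : W) :
    Ω.scalar l a b = l (Ω.form a b) := rfl

/-- The form `Ω.leftForm θ₀` is affine in the base point, so its derivative is a constant bilinear
map. Consequently the condition `dθ(a, α) = 0` defining `R` is orthogonality to the direction `w`,
at every base point. -/
theorem extDerivOne_leftForm (hθ₀ : LinearMap.ker θ₀.toLinearMap = Submodule.prod ⊤ ⊥)
    (x a b : W × I) :
    extDerivOne (Ω.leftForm θ₀) x a b = -centralForm θ₀ (Ω.form a.1 b.1) := by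
  set L : W × I →L[ℂ] W × I →L[ℂ] ℂ := (1 / 2 : ℂ) •
    ((ContinuousLinearMap.compL ℂ (W × I) W ℂ).flip (ContinuousLinearMap.fst ℂ W I) ∘L
      Ω.scalar (centralForm θ₀) ∘L ContinuousLinearMap.fst ℂ W I) with hL
  have h : Ω.leftForm θ₀ = fun x => centralForm θ₀ ∘L ContinuousLinearMap.snd ℂ W I - L x := by
    ext1 x
    refine ContinuousLinearMap.ext fun v => ?_
    rw [Ω.leftForm_apply, apply_eq_centralForm hθ₀]
    simp [hL]
  have hd : HasFDerivAt (Ω.leftForm θ₀) (-L) x := by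
    rw [h]
    exact L.hasFDerivAt.const_sub _
  rw [extDerivOne_apply hd.differentiableAt, hd.fderiv]
  have := Ω.form_swap b.1 a.1
  simp [hL, this]
  ring

end HeisenbergForm

/-! ### The contact form on an affine slice of the annihilator of a coframe -/

section AnnihilatorSlice

variable {Y : Type*} [NormedAddCommGroup Y] [NormedSpace ℂ Y]

/-- The common kernel of two 1-forms. -/
def coframeKer (α₁ α₂ : Y → Y →L[ℂ] ℂ) (y : Y) : Submodule ℂ Y :=
  LinearMap.ker (α₁ y).toLinearMap ⊓ LinearMap.ker (α₂ y).toLinearMap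

theorem mem_coframeKer {α₁ α₂ : Y → Y →L[ℂ] ℂ} {y v : Y} :
    v ∈ coframeKer α₁ α₂ y ↔ α₁ y v = 0 ∧ α₂ y v = 0 := Iff.rfl

/-- The covectors `ξ` at the points of `O` that annihilate `D` and satisfy `ξ e = 1`. -/
def annihilatorSlice (O : Set Y) (D : Y → Submodule ℂ Y) (e : Y) : Set (Y × (Y →L[ℂ] ℂ)) :=
  {p | p.1 ∈ O ∧ (∀ v ∈ D p.1, p.2 v = 0) ∧ p.2 e = 1}

/-- The null space of the restriction to `K` of the skew-symmetrization of `G`. -/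
def skewNull (K : Submodule ℂ Y) (G : Y →L[ℂ] Y →L[ℂ] ℂ) : Submodule ℂ Y where
  carrier := {v | v ∈ K ∧ ∀ u ∈ K, G v u = G u v}
  zero_mem' := ⟨zero_mem _, fun u _ => by simp⟩
  add_mem' := fun ha hb => ⟨add_mem ha.1 hb.1, fun u hu => by simp [ha.2 u hu, hb.2 u hu]⟩
  smul_mem' := fun k _ ha => ⟨Submodule.smul_mem _ k ha.1, fun u hu => by simp [ha.2 u hu]⟩

/-- Evaluate `ξ` on the projection of `u` to the common kernel along `e₁` and `e₂`. The coefficients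
are explicit in `ξ`, so along a holomorphic curve of covectors they can be differentiated. -/
theorem eq_combination_of_ker_le {a₁ a₂ ξ : Y →L[ℂ] ℂ} {e₁ e₂ : Y} (h₁ : a₁ e₁ = 1)
    (h₂ : a₂ e₁ = 0) (h₃ : a₂ e₂ ≠ 0) (hξ : ∀ v, a₁ v = 0 → a₂ v = 0 → ξ v = 0) :
    ξ = ξ e₁ • a₁ + ((ξ e₂ - ξ e₁ * a₁ e₂) / a₂ e₂) • a₂ := by
  refine ContinuousLinearMap.ext fun u => ?_
  have h := hξ (u - (a₂ u / a₂ e₂) • e₂ - (a₁ u - (a₂ u / a₂ e₂) * a₁ e₂) • e₁)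
    (by simp [h₁]) (by simp [h₂, h₃])
  simp only [map_sub, map_smul, smul_eq_mul] at h
  simp only [_root_.add_apply, _root_.smul_apply, smul_eq_mul]
  field_simp at h ⊢
  linear_combination h

theorem extDerivOne_tautForm (p u v : Y × (Y →L[ℂ] ℂ)) :
    extDerivOne tautForm p u v = u.2 v.1 - v.2 u.1 := by
  set L : Y × (Y →L[ℂ] ℂ) →L[ℂ] Y × (Y →L[ℂ] ℂ) →L[ℂ] ℂ :=
    (ContinuousLinearMap.compL ℂ (Y × (Y →L[ℂ] ℂ)) Y ℂ).flip (ContinuousLinearMap.fst ℂ Y _) ∘L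
      ContinuousLinearMap.snd ℂ Y _ with hL
  have h : (tautForm : Y × (Y →L[ℂ] ℂ) → _) = L := rfl
  have hd : fderiv ℂ (fun x => L x) p = L := by simp
  rw [h, extDerivOne_apply L.differentiableAt, hd]
  simp [hL]

variable {α₁ α₂ : Y → Y →L[ℂ] ℂ} {O : Set Y} {e e₁ e₂ y : Y} {ξ : Y →L[ℂ] ℂ} {p q : ℂ}

/-- The derivative at `y` of the 1-form `p α₁ + q α₂` with constant `p` and `q`. -/
def combinationDeriv (α₁ α₂ : Y → Y →L[ℂ] ℂ) (p q : ℂ) (y : Y) : Y →L[ℂ] Y →L[ℂ] ℂ :=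
  p • fderiv ℂ α₁ y + q • fderiv ℂ α₂ y

theorem hasDerivAt_combination {P Q : ℂ → ℂ} {c : ℂ → Y} {p' q' : ℂ} {v : Y}
    (hα₁ : AnalyticAt ℂ α₁ (c 0)) (hα₂ : AnalyticAt ℂ α₂ (c 0)) (hP : HasDerivAt P p' 0)
    (hQ : HasDerivAt Q q' 0) (hc : HasDerivAt c v 0) :
    HasDerivAt (fun t => P t • α₁ (c t) + Q t • α₂ (c t))
      (p' • α₁ (c 0) + q' • α₂ (c 0) + combinationDeriv α₁ α₂ (P 0) (Q 0) (c 0) v) 0 := by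
  have h₁ := hα₁.differentiableAt.hasFDerivAt.comp_hasDerivAt 0 hc
  have h₂ := hα₂.differentiableAt.hasFDerivAt.comp_hasDerivAt 0 hc
  refine ((hP.smul h₁).add (hQ.smul h₂)).congr_deriv ?_
  simp only [combinationDeriv, _root_.add_apply, _root_.smul_apply, Function.comp_apply]
  abel

/-- Near `(y, ξ)` the annihilator is parametrized by `(x, P, Q) ↦ (x, P α₁ x + Q α₂ x)`, and its
tangent vectors come from the product rule. The slice `ξ e = 1` adds the linear condition `η e = 0`.
-/
theorem mem_holTangent_annihilatorSlice (hO : IsOpen O) (hy : y ∈ O)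
    (h₁ : ∀ x ∈ O, α₁ x e₁ = 1) (h₂ : ∀ x ∈ O, α₂ x e₁ = 0) (h₃ : α₂ y e₂ ≠ 0)
    (hα₁ : AnalyticAt ℂ α₁ y) (hα₂ : AnalyticAt ℂ α₂ y) (hξ : ξ = p • α₁ y + q • α₂ y)
    (hξe : ξ e = 1) (v : Y) (η : Y →L[ℂ] ℂ) :
    (v, η) ∈ holTangent (annihilatorSlice O (coframeKer α₁ α₂) e) (y, ξ) ↔
      (∃ p' q' : ℂ, η = p' • α₁ y + q' • α₂ y + combinationDeriv α₁ α₂ p q y v) ∧ η e = 0 := by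
  constructor
  · intro h
    have key : ∀ u ∈ holTangent (annihilatorSlice O (coframeKer α₁ α₂) e) (y, ξ),
        (∃ p' q' : ℂ, u.2 = p' • α₁ y + q' • α₂ y + combinationDeriv α₁ α₂ p q y u.1) ∧
          u.2 e = 0 := by
      intro u hu
      induction hu using Submodule.span_induction with
      | mem u hu =>
        obtain ⟨c, hc, hc0, hcZ, rfl⟩ := hu
        have hcd := hc.differentiableAt.hasDerivAt
        have hd₁ : HasDerivAt (fun t => (c t).1) (deriv c 0).1 0 :=
          (ContinuousLinearMap.fst ℂ Y (Y →L[ℂ] ℂ)).hasFDerivAt.comp_hasDerivAt 0 hcd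
        have hd₂ : HasDerivAt (fun t => (c t).2) (deriv c 0).2 0 :=
          (ContinuousLinearMap.snd ℂ Y (Y →L[ℂ] ℂ)).hasFDerivAt.comp_hasDerivAt 0 hcd
        have hy0 : (c 0).1 = y := by rw [hc0]
        have hx0 : (c 0).2 = ξ := by rw [hc0]
        have hev (a : Y) {f : ℂ → Y →L[ℂ] ℂ} (hf : DifferentiableAt ℂ f 0) :
            DifferentiableAt ℂ (fun t => f t a) 0 := hf.clm_apply (differentiableAt_const a)
        have g₁ : DifferentiableAt ℂ (fun t => α₁ (c t).1) 0 :=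
          DifferentiableAt.fun_comp' (0 : ℂ) (hy0 ▸ hα₁.differentiableAt) hd₁.differentiableAt
        have g₂ : DifferentiableAt ℂ (fun t => α₂ (c t).1) 0 :=
          DifferentiableAt.fun_comp' (0 : ℂ) (hy0 ▸ hα₂.differentiableAt) hd₁.differentiableAt
        have hne : α₂ (c 0).1 e₂ ≠ 0 := by rwa [hy0]
        set P : ℂ → ℂ := fun t => (c t).2 e₁ with hP
        set Q : ℂ → ℂ := fun t => ((c t).2 e₂ - P t * α₁ (c t).1 e₂) / α₂ (c t).1 e₂ with hQ
        have hPd : DifferentiableAt ℂ P 0 := hev e₁ hd₂.differentiableAt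
        have hQd : DifferentiableAt ℂ Q 0 :=
          ((hev e₂ hd₂.differentiableAt).sub (hPd.mul (hev e₂ g₁))).div (hev e₂ g₂) hne
        have hP0 : P 0 = p := by simp [hP, hx0, hξ, h₁ y hy, h₂ y hy]
        have hQ0 : Q 0 = q := by
          simp only [hQ, hP0, hx0, hy0, hξ, _root_.add_apply, _root_.smul_apply, smul_eq_mul]
          field_simp
          ring
        -- Nonvanishing of `α₂` on `e₂` is assumed at `y` only; by continuity it persists along the
        -- curve for small `t`.
        have heq : (fun t => (c t).2) =ᶠ[𝓝 0] fun t => P t • α₁ (c t).1 + Q t • α₂ (c t).1 := by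
          filter_upwards [hcZ, (hev e₂ g₂).continuousAt.eventually_ne hne] with t ht ht'
          exact eq_combination_of_ker_le (h₁ _ ht.1) (h₂ _ ht.1) ht'
            fun v hv hv' => ht.2.1 v ⟨hv, hv'⟩
        have hd := (hasDerivAt_combination (hy0 ▸ hα₁) (hy0 ▸ hα₂) hPd.hasDerivAt
          hQd.hasDerivAt hd₁).congr_of_eventuallyEq heq
        rw [hP0, hQ0, hy0] at hd
        refine ⟨⟨_, _, hd₂.unique hd⟩, ?_⟩
        have h1 : HasDerivAt (fun t => (c t).2 e) ((deriv c 0).2 e) 0 :=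
          (ContinuousLinearMap.apply ℂ ℂ e).hasFDerivAt.comp_hasDerivAt 0 hd₂
        have h2 : HasDerivAt (fun t => (c t).2 e) 0 0 :=
          (hasDerivAt_const (0 : ℂ) (1 : ℂ)).congr_of_eventuallyEq (hcZ.mono fun t ht => ht.2.2)
        exact h1.unique h2
      | zero => exact ⟨⟨0, 0, ContinuousLinearMap.ext fun u => by simp⟩, by simp⟩
      | add a b _ _ ha hb =>
        obtain ⟨⟨p₁, q₁, h1⟩, h2⟩ := ha
        obtain ⟨⟨p₂, q₂, h3⟩, h4⟩ := hb
        refine ⟨⟨p₁ + p₂, q₁ + q₂, ?_⟩, by simp [h2, h4]⟩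
        rw [Prod.snd_add, h1, h3, Prod.fst_add, map_add]
        module
      | smul k a _ ha =>
        obtain ⟨⟨p₁, q₁, h1⟩, h2⟩ := ha
        refine ⟨⟨k * p₁, k * q₁, ?_⟩, by simp [h2]⟩
        rw [Prod.smul_snd, h1, Prod.smul_fst, map_smul]
        module
    exact key _ h
  · rintro ⟨⟨p', q', hη⟩, hηe⟩
    refine Submodule.subset_span ?_
    set X : ℂ → Y →L[ℂ] ℂ := fun t =>
      (p + t * p') • α₁ (y + t • v) + (q + t * q') • α₂ (y + t • v) with hX
    have hX0 : X 0 = ξ := by simp [hX, hξ]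
    have hXa : AnalyticAt ℂ X 0 := by
      have hl : AnalyticAt ℂ (fun t : ℂ => y + t • v) 0 := by fun_prop
      have g₁ : AnalyticAt ℂ (fun t : ℂ => α₁ (y + t • v)) 0 :=
        AnalyticAt.fun_comp (by simpa using hα₁) hl
      have g₂ : AnalyticAt ℂ (fun t : ℂ => α₂ (y + t • v)) 0 :=
        AnalyticAt.fun_comp (by simpa using hα₂) hl
      exact ((by fun_prop : AnalyticAt ℂ (fun t : ℂ => p + t * p') 0).smul g₁).add
        ((by fun_prop : AnalyticAt ℂ (fun t : ℂ => q + t * q') 0).smul g₂)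
    have hl : HasDerivAt (fun t : ℂ => y + t • v) v 0 := by
      simpa using ((hasDerivAt_id (0 : ℂ)).smul_const v).const_add y
    have hXd : HasDerivAt X η 0 := by
      have := hasDerivAt_combination (α₁ := α₁) (α₂ := α₂) (P := fun t => p + t * p')
        (Q := fun t => q + t * q') (c := fun t : ℂ => y + t • v) (p' := p') (q' := q')
        (by simpa using hα₁) (by simpa using hα₂)
        (by simpa using ((hasDerivAt_id (0 : ℂ)).mul_const p').const_add p)
        (by simpa using ((hasDerivAt_id (0 : ℂ)).mul_const q').const_add q) hl
      simpa [hη] using this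
    have hev : HasDerivAt (fun t => X t e) (η e) 0 :=
      (ContinuousLinearMap.apply ℂ ℂ e).hasFDerivAt.comp_hasDerivAt 0 hXd
    have heva : AnalyticAt ℂ (fun t => X t e) 0 :=
      (ContinuousLinearMap.apply ℂ ℂ e).analyticAt _ |>.fun_comp hXa
    have hne : X 0 e ≠ 0 := by simp [hX0, hξe]
    -- Dividing by `X t e` brings the curve into the slice. Its velocity does not change, since the
    -- factor is `1` at time `0` and has derivative `-η e = 0` there.
    have hd : HasDerivAt (fun t => (y + t • v, (X t e)⁻¹ • X t)) (v, η) 0 := by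
      refine hl.prodMk (((hev.fun_inv hne).smul hXd).congr_deriv ?_)
      simp [hX0, hξe, hηe]
    refine ⟨_, AnalyticAt.prod (by fun_prop) ((heva.inv hne).smul hXa), ?_, ?_, hd.deriv⟩
    · simp [hX0, hξe]
    · have hO' : ∀ᶠ t in 𝓝 (0 : ℂ), y + t • v ∈ O :=
        hl.continuousAt.eventually (by simpa using hO.mem_nhds hy)
      filter_upwards [hO', hev.continuousAt.eventually_ne hne] with t ht ht'
      refine ⟨ht, fun u hu => ?_, by simp [ht']⟩
      obtain ⟨hu₁, hu₂⟩ := mem_coframeKer.1 hu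
      simp only at hu₁ hu₂
      simp [hX, hu₁, hu₂]

/-- The projection `(v, η) ↦ v` is injective on the null space, and its image is `skewNull`. The
derivatives of the coefficients contribute to the 2-form only through `α₁` and `α₂`, which vanish on
their common kernel; what remains is the 2-form with constant `p` and `q`. -/
theorem finrank_formNull_annihilatorSlice (hO : IsOpen O) (hy : y ∈ O)
    (h₁ : ∀ x ∈ O, α₁ x e₁ = 1) (h₂ : ∀ x ∈ O, α₂ x e₁ = 0) (h₃ : α₂ y e₂ ≠ 0)
    (hα₁ : AnalyticAt ℂ α₁ y) (hα₂ : AnalyticAt ℂ α₂ y) (hξ : ξ = p • α₁ y + q • α₂ y)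
    (hξe : ξ e = 1) :
    Module.finrank ℂ (formNull (annihilatorSlice O (coframeKer α₁ α₂) e) tautForm (y, ξ)) =
      Module.finrank ℂ (skewNull (coframeKer α₁ α₂ y) (combinationDeriv α₁ α₂ p q y)) := by
  set Z := annihilatorSlice O (coframeKer α₁ α₂) e
  set G := combinationDeriv α₁ α₂ p q y
  set T := holTangent Z (y, ξ)
  have hT (v : Y) (η : Y →L[ℂ] ℂ) : (v, η) ∈ T ↔
      (∃ p' q' : ℂ, η = p' • α₁ y + q' • α₂ y + G v) ∧ η e = 0 :=
    mem_holTangent_annihilatorSlice hO hy h₁ h₂ h₃ hα₁ hα₂ hξ hξe v η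
  -- Every `v` lifts to a tangent vector of the slice: subtracting a multiple of `ξ`, itself a
  -- combination of `α₁ y` and `α₂ y`, makes the covector vanish on `e`.
  have hlift (v : Y) (a b : ℂ) : (v, a • α₁ y + b • α₂ y + G v -
      ((a • α₁ y + b • α₂ y + G v) e) • ξ) ∈ T := by
    rw [hT]
    refine ⟨⟨a - ((a • α₁ y + b • α₂ y + G v) e) * p,
      b - ((a • α₁ y + b • α₂ y + G v) e) * q, ?_⟩, by simp [hξe]⟩
    generalize (a • α₁ y + b • α₂ y + G v) e = r
    rw [hξ]
    module
  have hnull (v : Y) (η : Y →L[ℂ] ℂ) : (v, η) ∈ formNull Z tautForm (y, ξ) ↔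
      ((v, η) ∈ T ∧ ξ v = 0) ∧ ∀ u ζ, (u, ζ) ∈ T → ξ u = 0 → η u = ζ v := by
    refine and_congr Iff.rfl ⟨fun h u ζ hu hu' => ?_, fun h u hu => ?_⟩
    · have := h (u, ζ) ⟨hu, hu'⟩
      rw [extDerivOne_tautForm] at this
      exact sub_eq_zero.1 this
    · rw [extDerivOne_tautForm]
      exact sub_eq_zero.2 (h u.1 u.2 hu.1 hu.2)
  set F : formNull Z tautForm (y, ξ) →ₗ[ℂ] Y :=
    LinearMap.fst ℂ Y (Y →L[ℂ] ℂ) ∘ₗ (formNull Z tautForm (y, ξ)).subtype with hF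
  have hinj : Function.Injective F := by
    rw [injective_iff_map_eq_zero]
    rintro ⟨⟨v, η⟩, hv⟩ h0
    obtain rfl : v = 0 := h0
    obtain ⟨⟨hvT, -⟩, hv2⟩ := (hnull _ _).1 hv
    have hη : η = 0 := by
      refine ContinuousLinearMap.ext fun w => ?_
      -- Since `Y = ker ξ ⊕ ℂ e`, a covector vanishing on `ker ξ` and on `e` is zero.
      have := hv2 _ _ (hlift (w - ξ w • e) 0 0) (by simp [hξe])
      simpa [((hT _ _).1 hvT).2] using this
    subst hη
    rfl
  have hrange : LinearMap.range F = skewNull (coframeKer α₁ α₂ y) G := by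
    apply le_antisymm
    · rintro _ ⟨⟨⟨v, η⟩, hv⟩, rfl⟩
      obtain ⟨⟨hvT, hξv⟩, hv2⟩ := (hnull _ _).1 hv
      obtain ⟨⟨p', q', hη⟩, -⟩ := (hT _ _).1 hvT
      change v ∈ skewNull _ _
      refine ⟨⟨?_, ?_⟩, fun u hu => ?_⟩
      -- Test against the fibre direction `(0, α₁ y - α₁ y e • ξ)`; since `ξ v = 0`, this yields `α₁
      -- y v = 0`. The next line does the same for `α₂`.
      · simpa [hξv] using (hv2 _ _ (hlift 0 1 0) (by simp)).symm
      · simpa [hξv] using (hv2 _ _ (hlift 0 0 1) (by simp)).symm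
      · obtain ⟨hu₁, hu₂⟩ := mem_coframeKer.1 hu
        have := hv2 _ _ (hlift u 0 0) (by simp [hξ, hu₁, hu₂])
        simpa [hη, hu₁, hu₂, hξv] using this
    · rintro v ⟨hvK, hv⟩
      obtain ⟨hv₁, hv₂⟩ := mem_coframeKer.1 hvK
      have hξv : ξ v = 0 := by simp [hξ, hv₁, hv₂]
      -- Nullity requires `η` to agree with `u ↦ G u v` on `ker ξ`, and `η e = 0` fixes the multiple
      -- of `ξ`.
      refine ⟨⟨(v, G.flip v - (G e v) • ξ), ?_⟩, rfl⟩
      rw [hnull]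
      refine ⟨⟨?_, hξv⟩, fun u ζ hu hξu => ?_⟩
      · rw [hT]
        -- Tangency: `G.flip v - G v` vanishes on the common kernel because `v` is null there, so it
        -- is a combination of `α₁ y` and `α₂ y`.
        have := eq_combination_of_ker_le (ξ := G.flip v - G v) (h₁ y hy) (h₂ y hy) h₃
          fun u hu hu' => by simp [hv u ⟨hu, hu'⟩]
        generalize (G.flip v - G v) e₁ = r at this
        generalize ((G.flip v - G v) e₂ - r * α₁ y e₂) / α₂ y e₂ = s at this
        refine ⟨⟨r - G e v * p, s - G e v * q, ?_⟩, by simp [hξe]⟩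
        rw [sub_eq_iff_eq_add] at this
        rw [this, hξ]
        module
      · obtain ⟨⟨p', q', rfl⟩, -⟩ := (hT _ _).1 hu
        simp [hv₁, hv₂, hξu]
  rw [← hrange, LinearMap.finrank_range_of_inj hinj]

end AnnihilatorSlice

/-! ### Frames of the common kernel of a coframe -/

section CoframeProjection

variable {Y : Type*} [NormedAddCommGroup Y] [NormedSpace ℂ Y]
variable {α₁ α₂ : Y → Y →L[ℂ] ℂ} {e₁ e₂ y : Y}

/-- The projection of `u` to the common kernel of `α₁` and `α₂` along `e₁` and `e₂`, when
`α₁ e₁ = 1`, `α₂ e₁ = 0` and `α₂ e₂ ≠ 0`. -/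
def coframeProj (α₁ α₂ : Y → Y →L[ℂ] ℂ) (e₁ e₂ : Y) (y u : Y) : Y :=
  u - (α₂ y u / α₂ y e₂) • e₂ - (α₁ y u - (α₂ y u / α₂ y e₂) * α₁ y e₂) • e₁

theorem coframeProj_mem (h₁ : α₁ y e₁ = 1) (h₂ : α₂ y e₁ = 0) (h₃ : α₂ y e₂ ≠ 0) (u : Y) :
    coframeProj α₁ α₂ e₁ e₂ y u ∈ coframeKer α₁ α₂ y := by
  rw [mem_coframeKer]
  simp [coframeProj, h₁, h₂, h₃]

theorem finrank_coframeKer [FiniteDimensional ℂ Y] (h₁ : α₁ y e₁ = 1) (h₂ : α₂ y e₁ = 0)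
    (h₃ : α₂ y e₂ ≠ 0) : Module.finrank ℂ (coframeKer α₁ α₂ y) + 2 = Module.finrank ℂ Y := by
  set f : Y →ₗ[ℂ] ℂ × ℂ := (α₁ y).toLinearMap.prod (α₂ y).toLinearMap
  have hf : LinearMap.ker f = coframeKer α₁ α₂ y := LinearMap.ker_prod _ _
  have hr : LinearMap.range f = ⊤ := by
    rw [LinearMap.range_eq_top]
    rintro ⟨a, b⟩
    refine ⟨(a - b / α₂ y e₂ * α₁ y e₂) • e₁ + (b / α₂ y e₂) • e₂, ?_⟩
    simp [f, h₁, h₂, h₃]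
  have := f.finrank_range_add_finrank_ker
  rw [hr, hf, finrank_top, Module.finrank_prod, Module.finrank_self] at this
  omega

/-- A vector killed by the projection at `x` lies in the span of `e₁` and `e₂`, which meets the
common kernel at `y` only in zero. A basis of the kernel at one point thus gives independent vectors
at other points. -/
theorem linearIndependent_coframeProj {ι : Type*} {x : Y} {b : ι → Y}
    (hb : LinearIndependent ℂ b) (hbK : ∀ i, b i ∈ coframeKer α₁ α₂ y) (h₁ : α₁ y e₁ = 1)
    (h₂ : α₂ y e₁ = 0) (h₃ : α₂ y e₂ ≠ 0) :
    LinearIndependent ℂ fun i => coframeProj α₁ α₂ e₁ e₂ x (b i) := by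
  set P : Y →ₗ[ℂ] Y := LinearMap.id - LinearMap.smulRight ((α₂ x e₂)⁻¹ • (α₂ x).toLinearMap) e₂
    - LinearMap.smulRight ((α₁ x).toLinearMap - (α₁ x e₂ * (α₂ x e₂)⁻¹) • (α₂ x).toLinearMap) e₁
    with hP
  have hPe : (fun i => coframeProj α₁ α₂ e₁ e₂ x (b i)) = P ∘ b := by
    ext1 i
    simp only [coframeProj, hP, Function.comp_apply, LinearMap.sub_apply, LinearMap.id_apply,
      LinearMap.smulRight_apply, LinearMap.smul_apply, ContinuousLinearMap.coe_coe, smul_eq_mul]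
    congr 3 <;> ring
  rw [hPe]
  refine hb.map ?_
  rw [Submodule.disjoint_def]
  intro u hu hPu
  obtain ⟨hu₁, hu₂⟩ : α₁ y u = 0 ∧ α₂ y u = 0 :=
    (Submodule.span_le (p := coframeKer α₁ α₂ y)).2 (by rintro _ ⟨i, rfl⟩; exact hbK i) hu
  have hPu : P u = 0 := hPu
  have hu' : u = (α₂ x e₂)⁻¹ • (α₂ x u) • e₂ +
      (α₁ x u - (α₁ x e₂ * (α₂ x e₂)⁻¹) * α₂ x u) • e₁ := by
    simp only [hP, LinearMap.sub_apply, LinearMap.id_apply,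
      LinearMap.smulRight_apply, LinearMap.smul_apply, ContinuousLinearMap.coe_coe,
      smul_eq_mul] at hPu
    rw [sub_sub, sub_eq_zero] at hPu
    rw [smul_smul]
    exact hPu
  rw [smul_smul] at hu'
  generalize (α₂ x e₂)⁻¹ * α₂ x u = s at hu'
  generalize α₁ x u - (α₁ x e₂ * (α₂ x e₂)⁻¹) * α₂ x u = t at hu'
  have hs : s = 0 := by
    rw [hu'] at hu₂
    simpa [h₂, h₃] using hu₂
  subst hs
  have ht : t = 0 := by
    rw [hu'] at hu₁
    simpa [h₁] using hu₁
  simpa [ht] using hu'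

end CoframeProjection

/-! ### Distributions and annihilators in charts -/

section Manifold

variable {E : Type*} [NormedAddCommGroup E] [NormedSpace ℂ E]
variable {M : Type*} [TopologicalSpace M] [ChartedSpace E M] [IsManifold 𝓘(ℂ, E) ω M]

/-- The differential of the chart around `x₀` at `x`. -/
def chartDeriv {x₀ x : M} (hx : x ∈ (chartAt E x₀).source) : TangentSpace 𝓘(ℂ, E) x ≃L[ℂ] E :=
  haveI : IsManifold 𝓘(ℂ, E) 1 M := IsManifold.of_le (n := ω) le_top
  (mdifferentiable_chart (I := 𝓘(ℂ, E)) x₀).mfderiv hx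

theorem coe_chartDeriv {x₀ x : M} (hx : x ∈ (chartAt E x₀).source) :
    (chartDeriv hx : TangentSpace 𝓘(ℂ, E) x →L[ℂ] E) =
      mfderiv 𝓘(ℂ, E) 𝓘(ℂ, E) (chartAt E x₀) x := rfl

theorem chartCovector_apply {x₀ x : M} (hx : x ∈ (chartAt E x₀).source)
    (α : TangentSpace 𝓘(ℂ, E) x →L[ℂ] ℂ) (v : E) :
    chartCovector x₀ x α v = α ((chartDeriv hx).symm v) := by
  have h : (chartDeriv hx : TangentSpace 𝓘(ℂ, E) x →L[ℂ] E).inverse = (chartDeriv hx).symm :=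
    ContinuousLinearMap.inverse_equiv (chartDeriv hx)
  exact congrArg (fun A : E →L[ℂ] TangentSpace 𝓘(ℂ, E) x => α (A v)) h

/-- In the chart around `x₀`, the distribution `D` is given by the spaces `K`. -/
def IsChartExpression (D : ∀ x : M, Submodule ℂ (TangentSpace 𝓘(ℂ, E) x)) (x₀ : M)
    (K : E → Submodule ℂ E) : Prop :=
  ∀ x ∈ (chartAt E x₀).source, D x =
    (K (chartAt E x₀ x)).comap (mfderiv 𝓘(ℂ, E) 𝓘(ℂ, E) (chartAt E x₀) x).toLinearMap

/-- This reduces the null space on the projectivized annihilator to the computation on a slice in a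
vector space. -/
theorem affineCoord_image_projAnnihilator
    {D : ∀ x : M, Submodule ℂ (TangentSpace 𝓘(ℂ, E) x)} {x₀ : M} {K : E → Submodule ℂ E}
    (hD : IsChartExpression D x₀ K) (e : E) :
    affineCoord x₀ e '' (projAnnihilator D ∩ affineDomain x₀ e) =
      annihilatorSlice (chartAt E x₀).target K e := by
  ext ⟨y, ξ⟩
  constructor
  · rintro ⟨⟨x, α⟩, ⟨hα, hx, hne⟩, h⟩
    obtain ⟨rfl, rfl⟩ := Prod.ext_iff.1 h
    refine ⟨(chartAt E x₀).map_source hx, fun v hv => ?_, inv_mul_cancel₀ hne⟩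
    have hmem : α.rep ∈ α.submodule := by
      rw [Projectivization.submodule_eq]; exact Submodule.mem_span_singleton_self _
    have hv' : (chartDeriv hx).symm v ∈ D x := by
      rw [hD x hx]
      change chartDeriv hx ((chartDeriv hx).symm v) ∈ K (chartAt E x₀ x)
      rwa [ContinuousLinearEquiv.apply_symm_apply]
    have := hα α.rep hmem _ hv'
    rw [← chartCovector_apply hx] at this
    change (chartCovector x₀ x α.rep e)⁻¹ * chartCovector x₀ x α.rep v = 0
    simp only at this
    rw [this, mul_zero]
  · rintro ⟨hy, hξ, hξe⟩
    simp only at hy hξ hξe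
    set x := (chartAt E x₀).symm y with hxdef
    have hx : x ∈ (chartAt E x₀).source := (chartAt E x₀).map_target hy
    have hxy : chartAt E x₀ x = y := (chartAt E x₀).right_inv hy
    set β : TangentSpace 𝓘(ℂ, E) x →L[ℂ] ℂ := ξ ∘L (chartDeriv hx : TangentSpace 𝓘(ℂ, E) x →L[ℂ] E)
    have hβξ (v : E) : chartCovector x₀ x β v = ξ v := by
      rw [chartCovector_apply hx]
      change ξ (chartDeriv hx ((chartDeriv hx).symm v)) = _
      rw [ContinuousLinearEquiv.apply_symm_apply]
    have hβ : β ≠ 0 := by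
      intro h
      have := hβξ e
      rw [h, hξe] at this
      simp at this
    obtain ⟨a, ha⟩ := Projectivization.exists_smul_eq_mk_rep ℂ β hβ
    have ha0 : (a : ℂ) ≠ 0 := a.ne_zero
    have hrep (v : E) : chartCovector x₀ x (Projectivization.mk ℂ β hβ).rep v = a * ξ v := by
      rw [← ha, Units.smul_def, map_smul, _root_.smul_apply, hβξ, smul_eq_mul]
    refine ⟨ProjCotangent.ofCovector x β hβ, ⟨?_, hx, ?_⟩, ?_⟩
    · change ∀ α ∈ (Projectivization.mk ℂ β hβ).submodule, ∀ v ∈ D x, α v = 0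
      intro α hα v hv
      rw [Projectivization.submodule_mk] at hα
      obtain ⟨k, rfl⟩ := Submodule.mem_span_singleton.1 hα
      rw [hD x hx, hxy] at hv
      have : ξ (chartDeriv hx v) = 0 := hξ _ hv
      change k * ξ (chartDeriv hx v) = 0
      rw [this, mul_zero]
    · change chartCovector x₀ x (Projectivization.mk ℂ β hβ).rep e ≠ 0
      rw [hrep, hξe, mul_one]
      exact ha0
    · refine Prod.ext hxy (ContinuousLinearMap.ext fun v => ?_)
      change (chartCovector x₀ x (Projectivization.mk ℂ β hβ).rep e)⁻¹ *
        chartCovector x₀ x (Projectivization.mk ℂ β hβ).rep v = ξ v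
      rw [hrep, hrep, hξe, mul_one, inv_mul_cancel_left₀ ha0]

theorem twistedNull_eq_formNull {D : ∀ x : M, Submodule ℂ (TangentSpace 𝓘(ℂ, E) x)} {x₀ : M}
    {K : E → Submodule ℂ E} (hD : IsChartExpression D x₀ K) (e : E) (q : ProjCotangent E M) :
    twistedNull D x₀ e q =
      formNull (annihilatorSlice (chartAt E x₀).target K e) tautForm (affineCoord x₀ e q) := by
  rw [twistedNull, affineCoord_image_projAnnihilator hD]

/-- Extend a basis of the common kernel at `x₀` by `coframeProj` to holomorphic vector fields in the
chart, on the open set where `α₂` does not vanish on `e₂`. They are independent by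
`linearIndependent_coframeProj` and span by a dimension count. -/
theorem isDistributionOfCorank_of_isChartExpression [FiniteDimensional ℂ E]
    {D : ∀ x : M, Submodule ℂ (TangentSpace 𝓘(ℂ, E) x)} (hE : 2 ≤ Module.finrank ℂ E)
    (h : ∀ x₀ : M, ∃ (α₁ α₂ : E → E →L[ℂ] ℂ) (e₁ e₂ : E),
      IsChartExpression D x₀ (coframeKer α₁ α₂) ∧
      (∀ y ∈ (chartAt E x₀).target, AnalyticAt ℂ α₁ y ∧ AnalyticAt ℂ α₂ y ∧
        α₁ y e₁ = 1 ∧ α₂ y e₁ = 0) ∧ α₂ (chartAt E x₀ x₀) e₂ ≠ 0) :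
    IsDistributionOfCorank 2 D := by
  obtain ⟨r, hr⟩ := Nat.exists_eq_add_of_le' hE
  refine ⟨r, hr.symm, fun x₀ => ?_⟩
  obtain ⟨α₁, α₂, e₁, e₂, hD, hα, he₂⟩ := h x₀
  set φ := chartAt E x₀
  have hx₀ : φ x₀ ∈ φ.target := φ.map_source (mem_chart_source E x₀)
  obtain ⟨-, -, h₁, h₂⟩ := hα _ hx₀
  have hK := finrank_coframeKer h₁ h₂ he₂
  have b : Module.Basis (Fin r) ℂ (coframeKer α₁ α₂ (φ x₀)) :=
    Module.finBasisOfFinrankEq ℂ _ (by omega)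
  have hb : LinearIndependent ℂ fun i => (b i : E) :=
    b.linearIndependent.map' (coframeKer α₁ α₂ (φ x₀)).subtype (Submodule.ker_subtype _)
  set V : Fin r → E → E := fun i y => coframeProj α₁ α₂ e₁ e₂ y (b i) with hV
  have hαc (u : E) : ContinuousOn (fun y => α₂ y u) φ.target := fun y hy =>
    ((hα y hy).2.1.continuousAt.clm_apply continuousAt_const).continuousWithinAt
  set U₀ : Set E := φ.target ∩ (fun y => α₂ y e₂) ⁻¹' {0}ᶜ
  have hU₀ : IsOpen U₀ := (hαc e₂).isOpen_inter_preimage φ.open_target isOpen_compl_singleton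
  have hVa (i : Fin r) : ContDiffOn ℂ ω (V i) U₀ := by
    intro y hy
    obtain ⟨g₁, g₂, -, -⟩ := hα y hy.1
    have f₁ (u : E) : ContDiffAt ℂ ω (fun y => α₁ y u) y := g₁.contDiffAt.clm_apply contDiffAt_const
    have f₂ (u : E) : ContDiffAt ℂ ω (fun y => α₂ y u) y := g₂.contDiffAt.clm_apply contDiffAt_const
    have f₃ : ContDiffAt ℂ ω (fun y => α₂ y (b i) / α₂ y e₂) y := (f₂ _).div (f₂ _) hy.2
    have : ContDiffAt ℂ ω (V i) y := (contDiffAt_const.sub (f₃.smul contDiffAt_const)).sub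
      (((f₁ _).sub (f₃.mul (f₁ _))).smul contDiffAt_const)
    exact this.contDiffWithinAt
  have : IsManifold 𝓘(ℂ, E) (ω + 1) M := inferInstanceAs (IsManifold 𝓘(ℂ, E) ω M)
  have : IsManifold 𝓘(ℂ, E) 1 M := IsManifold.of_le (n := ω) le_top
  set t := trivializationAt E (TangentSpace 𝓘(ℂ, E)) x₀
  have htb : t.baseSet = φ.source := by simp [t, φ]
  set U := φ.source ∩ φ ⁻¹' U₀
  refine ⟨U, φ.isOpen_inter_preimage hU₀, ⟨mem_chart_source E x₀, hx₀, he₂⟩,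
    fun i x => t.symmL ℂ x (V i (φ x)), fun i => ?_, fun x hx => ?_⟩
  · refine (t.contMDiffOn_section_iff (φ.isOpen_inter_preimage hU₀) ?_).2 ?_
    · rw [htb]
      exact Set.inter_subset_left
    · have hφ : ContMDiffOn 𝓘(ℂ, E) 𝓘(ℂ, E) ω φ U :=
        (contMDiffOn_chart (I := 𝓘(ℂ, E)) (n := ω) (x := x₀)).mono Set.inter_subset_left
      refine ((hVa i).contMDiffOn.comp hφ fun x hx => hx.2).congr fun x hx => ?_
      have hxb : x ∈ t.baseSet := htb ▸ hx.1
      rw [← t.continuousLinearMapAt_apply_of_mem ℂ hxb]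
      exact t.continuousLinearMapAt_symmL hxb _
  · have hxb : x ∈ t.baseSet := htb ▸ hx.1
    obtain ⟨-, -, h₁', h₂'⟩ := hα _ hx.2.1
    set A := chartDeriv hx.1
    have hAt : t.continuousLinearMapAt ℂ x = (A : TangentSpace 𝓘(ℂ, E) x →L[ℂ] E) := by
      rw [TangentBundle.continuousLinearMapAt_trivializationAt hx.1]
      simp [A, coe_chartDeriv, extChartAt, mfld_simps]
      rfl
    have hA (i : Fin r) : A (t.symmL ℂ x (V i (φ x))) = V i (φ x) := by
      have := t.continuousLinearMapAt_symmL (R := ℂ) hxb (V i (φ x))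
      rwa [hAt] at this
    have hli : LinearIndependent ℂ fun i => t.symmL ℂ x (V i (φ x)) := by
      have := linearIndependent_coframeProj (x := φ x) hb (fun i => (b i).2) h₁ h₂ he₂
      refine LinearIndependent.of_comp A.toLinearEquiv.toLinearMap ?_
      convert this using 1
      ext1 i
      exact hA i
    refine ⟨hli, ?_⟩
    have hDK : D x = (coframeKer α₁ α₂ (φ x)).comap A.toLinearEquiv.toLinearMap := hD x hx.1
    have hle : Submodule.span ℂ (Set.range fun i => t.symmL ℂ x (V i (φ x))) ≤ D x := by
      rw [Submodule.span_le]
      rintro _ ⟨i, rfl⟩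
      rw [hDK]
      change A (t.symmL ℂ x (V i (φ x))) ∈ coframeKer α₁ α₂ (φ x)
      rw [hA]
      exact coframeProj_mem h₁' h₂' hx.2.2 _
    have : FiniteDimensional ℂ (TangentSpace 𝓘(ℂ, E) x) := inferInstanceAs (FiniteDimensional ℂ E)
    refine Submodule.eq_of_le_of_finrank_eq hle ?_
    rw [finrank_span_eq_card hli, Fintype.card_fin, hDK]
    have := finrank_coframeKer h₁' h₂' hx.2.2
    have h3 : Module.finrank ℂ ((coframeKer α₁ α₂ (φ x)).comap A.toLinearEquiv.toLinearMap) =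
        Module.finrank ℂ (coframeKer α₁ α₂ (φ x)) := by
      rw [Submodule.comap_equiv_eq_map_symm]
      exact LinearEquiv.finrank_map_eq _ _
    omega

end Manifold

/-! ### Isotropy of the tangent spaces of a Legendrian cone -/

section Isotropy

variable {E W : Type*} [NormedAddCommGroup E] [NormedSpace ℂ E] [NormedAddCommGroup W]
  [NormedSpace ℂ W]

/-- Differentiate `B(n, dn v) = 0` in the direction `u` and subtract the same identity with `u` and
`v` exchanged. The second derivatives cancel by symmetry, leaving twice the desired value. -/
theorem isotropic_fderiv {B : W →L[ℂ] W →L[ℂ] ℂ} (hB : ∀ a b, B a b = -B b a) {n : E → W} {a : E}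
    (hn : ContDiffAt ℂ ω n a) (h : ∀ᶠ x in 𝓝 a, ∀ v, B (n x) (fderiv ℂ n x v) = 0) (u v : E) :
    B (fderiv ℂ n a u) (fderiv ℂ n a v) = 0 := by
  have hd : DifferentiableAt ℂ (fderiv ℂ n) a :=
    (hn.fderiv_right (m := ω) le_rfl).differentiableAt (by simp)
  have hsymm : IsSymmSndFDerivAt ℂ n a := hn.isSymmSndFDerivAt (by simp)
  have key (u v : E) : B (fderiv ℂ n a u) (fderiv ℂ n a v)
      + B (n a) (fderiv ℂ (fderiv ℂ n) a u v) = 0 := by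
    have h1 : HasFDerivAt (fun x => fderiv ℂ n x v)
        ((fderiv ℂ (fderiv ℂ n) a).flip v) a := by
      simpa using hd.hasFDerivAt.clm_apply (hasFDerivAt_const v a)
    have h2 := B.hasFDerivAt_of_bilinear (hn.differentiableAt (by simp)).hasFDerivAt h1
    have h3 : HasFDerivAt (fun x => B (n x) (fderiv ℂ n x v)) (0 : E →L[ℂ] ℂ) a :=
      (hasFDerivAt_const (0 : ℂ) a).congr_of_eventuallyEq (h.mono fun x hx => hx v)
    have := congrArg (fun L : E →L[ℂ] ℂ => L u) (h2.unique h3)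
    simpa [add_comm] using this
  have h1 := key u v
  have h2 := key v u
  rw [hsymm.eq v u, hB] at h2
  linear_combination (1 / 2 : ℂ) * (h1 - h2)

end Isotropy

/-! ### Symplectic linear algebra -/

section LagrangianGraph

variable {E W : Type*} [NormedAddCommGroup E] [NormedSpace ℂ E]
  [NormedAddCommGroup W] [NormedSpace ℂ W]
variable {B : W →L[ℂ] W →L[ℂ] ℂ} {t : W →L[ℂ] ℂ} {N : W} {D : E →L[ℂ] W}

theorem apply_eq_neg_of_alternating (halt : ∀ w, B w w = 0) (x y : W) : B x y = -B y x := by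
  have := halt (x + y)
  simp only [map_add, _root_.add_apply, halt] at this
  linear_combination this

/-- The space `ℂ N ⊕ im D` is isotropic of half the dimension of `W`, so it is its own orthogonal
and contains `w`. Applying `t` removes the `N`-component. -/
theorem exists_eq_of_orthogonal [FiniteDimensional ℂ E] [FiniteDimensional ℂ W]
    (halt : ∀ w, B w w = 0) (hB : ∀ w, (∀ w', B w w' = 0) → w = 0)
    (hdim : Module.finrank ℂ W = 2 * (Module.finrank ℂ E + 1)) (ht : t N = 1)
    (htD : ∀ u, t (D u) = 0) (hD : Function.Injective D) (hND : ∀ u, B N (D u) = 0)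
    (hDD : ∀ u v, B (D u) (D v) = 0) {w : W} (htw : t w = 0) (hNw : B N w = 0)
    (hDw : ∀ u, B (D u) w = 0) : ∃ u, D u = w := by
  set b : LinearMap.BilinForm ℂ W := ContinuousLinearMap.toLinearMap₁₂ B with hb
  have hbB (x y : W) : b x y = B x y := rfl
  have halt' : b.IsAlt := halt
  have hswap := apply_eq_neg_of_alternating halt
  have hnd : b.Nondegenerate := by
    have hr : LinearMap.IsRefl b := halt'.isRefl
    exact hr.nondegenerate_iff_separatingLeft.2 fun x hx => hB x hx
  set j : ℂ × E →ₗ[ℂ] W := (LinearMap.toSpanSingleton ℂ W N).coprod D.toLinearMap with hj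
  have hjapp (c : ℂ) (u : E) : j (c, u) = c • N + D u := by simp [hj]
  have hinj : Function.Injective j := by
    rw [injective_iff_map_eq_zero]
    rintro ⟨c, u⟩ h
    rw [hjapp] at h
    have hc : c = 0 := by simpa [ht, htD] using congrArg t h
    subst hc
    have : D u = D 0 := by simpa using h
    rw [hD this]
    rfl
  have hfin : Module.finrank ℂ (LinearMap.range j) = Module.finrank ℂ E + 1 := by
    rw [LinearMap.finrank_range_of_inj hinj, Module.finrank_prod, Module.finrank_self, add_comm]
  have hle : LinearMap.range j ≤ b.orthogonal (LinearMap.range j) := by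
    rintro _ ⟨⟨c, u⟩, rfl⟩ _ ⟨⟨c', u'⟩, rfl⟩
    have := hswap (D u') N
    simp [hbB, hjapp, halt, hND, hDD, this]
  have heq := Submodule.eq_of_le_of_finrank_eq hle (by
    rw [LinearMap.BilinForm.finrank_orthogonal hnd, hfin, hdim]; omega)
  have hw : w ∈ b.orthogonal (LinearMap.range j) := by
    rintro _ ⟨⟨c, u⟩, rfl⟩
    simp [hbB, hjapp, hNw, hDw]
  rw [← heq] at hw
  obtain ⟨⟨c, u⟩, rfl⟩ := hw
  rw [hjapp] at htw ⊢
  have hc : c = 0 := by simpa [ht, htD] using htw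
  exact ⟨u, by simp [hc]⟩

/-- The hyperplane `N^⊥` is spanned by `N` and `N^⊥ ∩ ker t`, so `x` is orthogonal to all of it.
Hence `x` is a multiple of `N`, and `t x = 0` makes it zero. -/
theorem eq_zero_of_orthogonal (halt : ∀ w, B w w = 0) (hB : ∀ w, (∀ w', B w w' = 0) → w = 0)
    (ht : t N = 1) {x : W} (htx : t x = 0) (hNx : B x N = 0)
    (hx : ∀ k, t k = 0 → B N k = 0 → B x k = 0) : x = 0 := by
  have hN : ∃ w₀, B N w₀ = 1 := by
    by_contra! h
    have : N = 0 := hB N fun w => by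
      by_contra hw
      exact h ((B N w)⁻¹ • w) (by simp [hw])
    simp [this] at ht
  obtain ⟨w₀, hw₀⟩ := hN
  have hx' (w : W) (hw : B N w = 0) : B x w = 0 := by
    have := hx (w - t w • N) (by simp [ht]) (by simp [hw, halt])
    simpa [hNx] using this
  have hxN : x = B x w₀ • N := by
    rw [← sub_eq_zero]
    refine hB _ fun w => ?_
    have := hx' (w - B N w • w₀) (by simp [hw₀])
    simp only [map_sub, map_smul, smul_eq_mul, _root_.sub_apply, _root_.smul_apply] at this ⊢
    linear_combination this
  rw [hxN] at htx
  have : B x w₀ = 0 := by simpa [ht] using htx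
  rw [hxN, this, zero_smul]

end LagrangianGraph

/-! ### The coframe on the model of the space of lines and its null space -/

section LineModel

variable {E W I : Type*} [NormedAddCommGroup E] [NormedSpace ℂ E]
  [NormedAddCommGroup W] [NormedSpace ℂ W] [NormedAddCommGroup I] [NormedSpace ℂ I]

/-- The inclusion of the hyperplane on which the first coordinate of `T` vanishes. -/
def hypIncl (T : W ≃L[ℂ] ℂ × HypModel W) : HypModel W →L[ℂ] W :=
  T.symm ∘L ContinuousLinearMap.inr ℂ ℂ (HypModel W)

/-- The projection to the hyperplane coordinates of `T`. -/
def hypProj (T : W ≃L[ℂ] ℂ × HypModel W) : W →L[ℂ] HypModel W :=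
  ContinuousLinearMap.snd ℂ ℂ (HypModel W) ∘L (T : W →L[ℂ] ℂ × HypModel W)

/-- The first coordinate of `T`. -/
def hypForm (T : W ≃L[ℂ] ℂ × HypModel W) : W →L[ℂ] ℂ :=
  ContinuousLinearMap.fst ℂ ℂ (HypModel W) ∘L (T : W →L[ℂ] ℂ × HypModel W)

variable (T : W ≃L[ℂ] ℂ × HypModel W)

theorem hypIncl_apply (h : HypModel W) : hypIncl T h = T.symm (0, h) := rfl

theorem hypProj_apply (w : W) : hypProj T w = (T w).2 := rfl

theorem hypForm_apply (w : W) : hypForm T w = (T w).1 := rfl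

@[simp] theorem hypForm_hypIncl (h : HypModel W) : hypForm T (hypIncl T h) = 0 := by
  simp [hypForm_apply, hypIncl_apply]

@[simp] theorem hypProj_hypIncl (h : HypModel W) : hypProj T (hypIncl T h) = h := by
  simp [hypProj_apply, hypIncl_apply]

theorem hypIncl_hypProj {w : W} (hw : hypForm T w = 0) : hypIncl T (hypProj T w) = w := by
  rw [hypIncl_apply, ContinuousLinearEquiv.symm_apply_eq]
  exact Prod.ext hw.symm rfl

variable (E I) in
/-- The hyperplane component of a point of the model of the space of lines. -/
def lineVec : E × (HypModel W × I) →L[ℂ] W :=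
  hypIncl T ∘L ContinuousLinearMap.fst ℂ (HypModel W) I ∘L ContinuousLinearMap.snd ℂ E _

@[simp] theorem lineVec_apply (y : E × (HypModel W × I)) : lineVec E I T y = hypIncl T y.2.1 := rfl

/-- The bilinear map `(w, v) ↦ B w v'`, where `v'` is the hyperplane component of `v`. -/
def vecPairing (B : W →L[ℂ] W →L[ℂ] ℂ) : W →L[ℂ] E × (HypModel W × I) →L[ℂ] ℂ :=
  (ContinuousLinearMap.compL ℂ (E × (HypModel W × I)) W ℂ).flip (lineVec E I T) ∘L B

@[simp] theorem vecPairing_apply (B : W →L[ℂ] W →L[ℂ] ℂ) (w : W) (v : E × (HypModel W × I)) :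
    vecPairing T B w v = B w (hypIncl T v.2.1) := rfl

/-- The 1-form on the model of the space of lines that is given by the left-invariant contact form
on the points of lines at which the first coordinate of `T` vanishes. -/
def centralCoform (B : W →L[ℂ] W →L[ℂ] ℂ) (l : I →L[ℂ] ℂ) (y : E × (HypModel W × I)) :
    E × (HypModel W × I) →L[ℂ] ℂ :=
  l ∘L ContinuousLinearMap.snd ℂ (HypModel W) I ∘L ContinuousLinearMap.snd ℂ E _ -
    ((1 / 2 : ℂ) • vecPairing T B ∘L lineVec E I T) y

/-- The 1-form on the model of the space of lines that pairs a vector with the direction `n`. -/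
def directionCoform (B : W →L[ℂ] W →L[ℂ] ℂ) (n : E → W) (y : E × (HypModel W × I)) :
    E × (HypModel W × I) →L[ℂ] ℂ :=
  vecPairing T B (n y.1)

theorem centralCoform_apply (B : W →L[ℂ] W →L[ℂ] ℂ) (l : I →L[ℂ] ℂ)
    (y v : E × (HypModel W × I)) : centralCoform T B l y v =
      l v.2.2 - (1 / 2 : ℂ) * B (hypIncl T y.2.1) (hypIncl T v.2.1) := rfl

theorem directionCoform_apply (B : W →L[ℂ] W →L[ℂ] ℂ) (n : E → W)
    (y v : E × (HypModel W × I)) :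
    directionCoform T B n y v = B (n y.1) (hypIncl T v.2.1) := rfl

variable {T} {B : W →L[ℂ] W →L[ℂ] ℂ} {l : I →L[ℂ] ℂ} {n : E → W}

theorem hasFDerivAt_centralCoform (y : E × (HypModel W × I)) :
    HasFDerivAt (centralCoform T B l : E × (HypModel W × I) → _)
      (-((1 / 2 : ℂ) • vecPairing T B ∘L lineVec E I T)) y :=
  (ContinuousLinearMap.hasFDerivAt
    ((1 / 2 : ℂ) • vecPairing T B ∘L lineVec E I T : E × (HypModel W × I) →L[ℂ]
      E × (HypModel W × I) →L[ℂ] ℂ)).const_sub _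

theorem hasFDerivAt_directionCoform {y : E × (HypModel W × I)} (hn : DifferentiableAt ℂ n y.1) :
    HasFDerivAt (directionCoform T B n : E × (HypModel W × I) → _)
      (vecPairing T B ∘L fderiv ℂ n y.1 ∘L ContinuousLinearMap.fst ℂ E _) y :=
  (vecPairing (E := E) (I := I) T B).hasFDerivAt.comp y (hn.hasFDerivAt.comp y hasFDerivAt_fst)

theorem analyticAt_centralCoform (y : E × (HypModel W × I)) :
    AnalyticAt ℂ (centralCoform T B l : E × (HypModel W × I) → _) y :=
  analyticAt_const.sub (ContinuousLinearMap.analyticAt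
    ((1 / 2 : ℂ) • vecPairing T B ∘L lineVec E I T : E × (HypModel W × I) →L[ℂ]
      E × (HypModel W × I) →L[ℂ] ℂ) y)

theorem analyticAt_directionCoform {y : E × (HypModel W × I)} (hn : AnalyticAt ℂ n y.1) :
    AnalyticAt ℂ (directionCoform T B n : E × (HypModel W × I) → _) y :=
  ((vecPairing (E := E) (I := I) T B).analyticAt _).comp (hn.comp analyticAt_fst)

theorem combinationDeriv_lineModel {y : E × (HypModel W × I)} (hn : DifferentiableAt ℂ n y.1)
    (p q : ℂ) (v u : E × (HypModel W × I)) :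
    combinationDeriv (centralCoform T B l) (directionCoform T B n) p q y v u =
      -(p / 2) * B (hypIncl T v.2.1) (hypIncl T u.2.1)
        + q * B (fderiv ℂ n y.1 v.1) (hypIncl T u.2.1) := by
  rw [combinationDeriv, (hasFDerivAt_centralCoform y).fderiv,
    (hasFDerivAt_directionCoform hn).fderiv]
  simp
  ring

/-- The null space is the image of an injective linear map `F` from `E`, with `x`-component `s u`
and hyperplane component `r D u`, where `[s : r] = [p : q]`. This treats the graph case `p ≠ 0` and
the degenerate case `p = 0` together. -/
theorem finrank_skewNull_lineModel [FiniteDimensional ℂ E] [FiniteDimensional ℂ W]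
    {y : E × (HypModel W × I)} (halt : ∀ w, B w w = 0)
    (hB : ∀ w, (∀ w', B w w' = 0) → w = 0)
    (hdim : Module.finrank ℂ W = 2 * (Module.finrank ℂ E + 1))
    (hl : Function.Bijective l) (hn : DifferentiableAt ℂ n y.1) (ht : hypForm T (n y.1) = 1)
    (htD : ∀ u, hypForm T (fderiv ℂ n y.1 u) = 0) (hD : Function.Injective (fderiv ℂ n y.1))
    (hND : ∀ u, B (n y.1) (fderiv ℂ n y.1 u) = 0)
    (hDD : ∀ u v, B (fderiv ℂ n y.1 u) (fderiv ℂ n y.1 v) = 0) {p q : ℂ}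
    (hpq : p ≠ 0 ∨ q ≠ 0) :
    Module.finrank ℂ (skewNull (coframeKer (centralCoform T B l) (directionCoform T B n) y)
      (combinationDeriv (centralCoform T B l) (directionCoform T B n) p q y)) =
        Module.finrank ℂ E := by
  set N := n y.1
  set D := fderiv ℂ n y.1
  set ι := hypIncl T
  have hswap := apply_eq_neg_of_alternating halt
  have hιD (u : E) : ι (hypProj T (D u)) = D u := hypIncl_hypProj T (htD u)
  obtain ⟨z, hz⟩ := hl.2 1
  -- Normalize `[p : q]` to `[1 : q / p]`, or to `[0 : 1]` if `p = 0`.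
  obtain ⟨s, r, hsr, hs⟩ : ∃ s r : ℂ, p * r = q * s ∧ (s = 1 ∨ s = 0 ∧ r = 1 ∧ p = 0) := by
    by_cases hp : p = 0
    · exact ⟨0, 1, by simp [hp], Or.inr ⟨rfl, rfl, hp⟩⟩
    · exact ⟨1, q / p, by field_simp, Or.inl rfl⟩
  -- The last component is the one imposed by the vanishing of `centralCoform`, using `l z = 1`.
  set F : E →ₗ[ℂ] E × (HypModel W × I) := (s • LinearMap.id).prod
    ((r • (hypProj T ∘L D).toLinearMap).prod
      (LinearMap.smulRight ((r / 2) • (B (ι y.2.1) ∘L D).toLinearMap) z)) with hF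
  have hFapp (u : E) : F u =
    (s • u, r • hypProj T (D u), (r / 2 * B (ι y.2.1) (D u)) • z) := rfl
  have hFinj : Function.Injective F := by
    rw [injective_iff_map_eq_zero]
    intro u hu
    rw [hFapp] at hu
    obtain ⟨h1, h2⟩ := Prod.ext_iff.1 hu
    rcases hs with rfl | ⟨rfl, rfl, -⟩
    · simpa using h1
    · have h3 : hypProj T (D u) = 0 := by simpa using (Prod.ext_iff.1 h2).1
      have h4 : D u = D 0 := by rw [← hιD u, h3]; simp
      exact hD h4
  suffices h : skewNull (coframeKer (centralCoform T B l) (directionCoform T B n) y)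
      (combinationDeriv (centralCoform T B l) (directionCoform T B n) p q y) = LinearMap.range F by
    rw [h, LinearMap.finrank_range_of_inj hFinj]
  apply le_antisymm
  · rintro ⟨x, h, c⟩ ⟨hvK, hv⟩
    rw [mem_coframeKer, centralCoform_apply, directionCoform_apply] at hvK
    obtain ⟨hv₁, hv₂⟩ := hvK
    simp only at hv₁ hv₂
    have hv₁ : l c = 1 / 2 * B (ι y.2.1) (ι h) := sub_eq_zero.1 hv₁
    have hv₂ : B N (ι h) = 0 := hv₂
    -- Test against vectors of the kernel with zero `E`-component. Their hyperplane components are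
    -- all `k` with `t k = 0` and `B N k = 0`, so `eq_zero_of_orthogonal` applies.
    have hzero : -p • ι h + q • D x = 0 := by
      refine eq_zero_of_orthogonal (t := hypForm T) halt hB ht (by simp [htD, ι]) ?_ ?_
      · rw [hswap]
        simp [hv₂, hND]
      · intro k hk hNk
        have hιk := hypIncl_hypProj T hk
        have := hv (0, hypProj T k, (1 / 2 * B (ι y.2.1) k) • z) (by
          rw [mem_coframeKer, centralCoform_apply, directionCoform_apply]
          simp only [hιk, map_smul, hz, smul_eq_mul, mul_one]
          exact ⟨sub_self _, hNk⟩)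
        rw [combinationDeriv_lineModel hn, combinationDeriv_lineModel hn] at this
        simp only [hιk, map_zero, _root_.zero_apply, mul_zero, add_zero] at this
        have h2 := hswap k (ι h)
        simp only [map_add, map_smul, _root_.add_apply, _root_.smul_apply, smul_eq_mul]
        linear_combination this - p / 2 * h2
    have hq (u : E) : q * B (D u) (ι h) = 0 := by
      have := hv (u, 0, 0) (by
        rw [mem_coframeKer, centralCoform_apply, directionCoform_apply]
        simp)
      rw [combinationDeriv_lineModel hn, combinationDeriv_lineModel hn] at this
      simpa using this.symm
    have hc (w : E) (hw : ι h = r • D w) : c = (r / 2 * B (ι y.2.1) (D w)) • z := by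
      apply hl.1
      rw [hv₁, hw, map_smul, map_smul, hz, smul_eq_mul, smul_eq_mul]
      ring
    have hh (w : E) (hw : ι h = r • D w) : h = r • hypProj T (D w) := by
      rw [← map_smul, ← hw, hypProj_hypIncl]
    by_cases hp : p = 0
    -- Here `hzero` gives `x = 0`, and `hq` places `ι h` in the orthogonal of the Lagrangian space.
    · have hq0 : q ≠ 0 := hpq.resolve_left (by simpa using hp)
      have hDx : D x = D 0 := by simpa [hp, hq0] using hzero
      have hx : x = 0 := hD hDx
      obtain ⟨u, hu⟩ := exists_eq_of_orthogonal (t := hypForm T) halt hB hdim ht htD hD hND hDD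
        (w := ι h) (by simp [ι]) hv₂ fun u => by simpa [hq0] using hq u
      have hs0 : s = 0 := by simpa [hp, hq0] using hsr
      rcases hs with rfl | ⟨-, rfl, -⟩
      · simp at hs0
      · have hu' : ι h = (1 : ℂ) • D u := by rw [hu, one_smul]
        refine ⟨u, ?_⟩
        rw [hFapp, ← hh u hu', ← hc u hu', hs0, hx, zero_smul]
    · rcases hs with rfl | ⟨-, -, h0⟩
      · have hu : ι h = r • D x := by
          have : p • ι h = p • r • D x := by
            rw [smul_smul, hsr, mul_one]
            rw [neg_smul, neg_add_eq_zero] at hzero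
            exact hzero
          exact smul_right_injective W hp this
        refine ⟨x, ?_⟩
        rw [hFapp, ← hh x hu, ← hc x hu, one_smul]
      · exact absurd h0 hp
  · rintro _ ⟨u, rfl⟩
    rw [hFapp]
    refine ⟨?_, fun v hv => ?_⟩
    · rw [mem_coframeKer, centralCoform_apply, directionCoform_apply]
      change _ = (0 : ℂ) ∧ B N (ι _) = 0
      simp only [map_smul, hιD, hz, hND, smul_eq_mul]
      have hιu : hypIncl T (hypProj T (D u)) = D u := hιD u
      rw [hιu]
      constructor <;> ring
    · rw [combinationDeriv_lineModel hn, combinationDeriv_lineModel hn]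
      change -(p / 2) * B (ι _) (ι _) + q * B (D _) (ι _) =
        -(p / 2) * B (ι _) (ι _) + q * B (D _) (ι _)
      simp only [map_smul, hιD, _root_.smul_apply, smul_eq_mul, hDD]
      have := hswap (ι v.2.1) (D u)
      linear_combination (p / 2 * r) * this - B (D u) (ι v.2.1) * hsr

end LineModel

/-! ### Normalized directions and the line projection in coordinates -/

section LineCharts

variable {E W I : Type*} [NormedAddCommGroup E] [NormedSpace ℂ E]
  [NormedAddCommGroup W] [NormedSpace ℂ W] [FiniteDimensional ℂ W]
  [NormedAddCommGroup I] [NormedSpace ℂ I]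
variable (Ω : SymplecticForm W I) (S : Set (ℙ ℂ W)) [ChartedSpace E S]

/-- The normalized direction vector at the point of `S` with coordinate `a` in the chart `φ`. -/
def lineDir (φ : OpenPartialHomeomorph S E) (T : W ≃L[ℂ] ℂ × HypModel W) (a : E) : W :=
  normRep T (φ.symm a : ℙ ℂ W)

variable {S} {T : W ≃L[ℂ] ℂ × HypModel W}

theorem hypForm_lineDir {φ : OpenPartialHomeomorph S E} {a : E} (ha' : φ.symm a ∈ lineBase S φ T) :
    hypForm T (lineDir S φ T a) = 1 := fst_normRep T _ ha'.2

theorem lineDir_ne_zero {φ : OpenPartialHomeomorph S E} {a : E}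
    (ha' : φ.symm a ∈ lineBase S φ T) : lineDir S φ T a ≠ 0 := by
  intro h
  have := hypForm_lineDir ha'
  simp [h] at this

theorem lineDir_mem_puncturedCone {φ : OpenPartialHomeomorph S E} {a : E}
    (ha' : φ.symm a ∈ lineBase S φ T) : lineDir S φ T a ∈ puncturedCone S := by
  refine ⟨lineDir_ne_zero ha', ?_⟩
  rw [← eq_mk_of_mem _ _ (lineDir_ne_zero ha') (normRep_mem T _)]
  exact (φ.symm a).2

theorem eventually_symm_mem_lineBase {φ : OpenPartialHomeomorph S E} {a : E} (ha : a ∈ φ.target)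
    (ha' : φ.symm a ∈ lineBase S φ T) :
    ∀ᶠ x in 𝓝 a, x ∈ φ.target ∧ φ.symm x ∈ lineBase S φ T :=
  (φ.symm.isOpen_inter_preimage (isOpen_lineBase S φ T)).mem_nhds ⟨ha, ha'⟩

variable {s₀ : S} {a : E}

section

variable [IsComplexSubmanifold E S]

theorem contDiffAt_lineDir (ha : a ∈ (chartAt E s₀).target)
    (ha' : (chartAt E s₀).symm a ∈ lineBase S (chartAt E s₀) T) :
    ContDiffAt ℂ ω (lineDir S (chartAt E s₀) T) a := by
  rw [← contMDiffAt_iff_contDiffAt]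
  have hsymm : ContMDiffAt 𝓘(ℂ, E) 𝓘(ℂ, E) ω (chartAt E s₀).symm a :=
    (contMDiffOn_chart_symm (I := 𝓘(ℂ, E)) (n := ω) (x := s₀)).contMDiffAt
      ((chartAt E s₀).open_target.mem_nhds ha)
  exact (contMDiffAt_normRep S T _ ha'.2).comp a hsymm

theorem hypForm_fderiv_lineDir (ha : a ∈ (chartAt E s₀).target)
    (ha' : (chartAt E s₀).symm a ∈ lineBase S (chartAt E s₀) T) (u : E) :
    hypForm T (fderiv ℂ (lineDir S (chartAt E s₀) T) a u) = 0 := by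
  have hd := ((contDiffAt_lineDir ha ha').differentiableAt (by simp)).hasFDerivAt
  have h1 := (hypForm T).hasFDerivAt.comp a hd
  have h2 : HasFDerivAt (hypForm T ∘ lineDir S (chartAt E s₀) T) (0 : E →L[ℂ] ℂ) a :=
    (hasFDerivAt_const (1 : ℂ) a).congr_of_eventuallyEq
      ((eventually_symm_mem_lineBase ha ha').mono fun x hx => hypForm_lineDir hx.2)
  exact congrArg (fun L : E →L[ℂ] ℂ => L u) (h1.unique h2)

/-- The curve `t ↦ n(a + t u)` stays in the punctured cone, so its velocity is tangent to the cone.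
-/
theorem form_lineDir_fderiv (hS : IsLegendrian Ω S)
    (ha : a ∈ (chartAt E s₀).target)
    (ha' : (chartAt E s₀).symm a ∈ lineBase S (chartAt E s₀) T) (u : E) :
    Ω.form (lineDir S (chartAt E s₀) T a) (fderiv ℂ (lineDir S (chartAt E s₀) T) a u) = 0 := by
  refine hS _ (lineDir_mem_puncturedCone ha') _ (Submodule.subset_span ?_)
  have hl : HasDerivAt (fun t : ℂ => a + t • u) u 0 := by
    simpa using ((hasDerivAt_id (0 : ℂ)).smul_const u).const_add a
  have hn := contDiffAt_lineDir ha ha'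
  generalize hν : lineDir S (chartAt E s₀) T = ν at hn
  have hc : AnalyticAt ℂ (fun t : ℂ => ν (a + t • u)) 0 :=
    AnalyticAt.fun_comp (by simpa using hn.analyticAt) (by fun_prop)
  have hd : HasDerivAt (fun t : ℂ => ν (a + t • u)) (fderiv ℂ ν a u) 0 := by
    have : HasFDerivAt ν (fderiv ℂ ν a) (a + (0 : ℂ) • u) := by
      simpa using (hn.differentiableAt (by simp)).hasFDerivAt
    exact this.comp_hasDerivAt 0 hl
  refine ⟨_, hc, by simp, ?_, hd.deriv⟩
  have := hl.continuousAt.eventually (p := fun x => x ∈ (chartAt E s₀).target ∧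
    (chartAt E s₀).symm x ∈ lineBase S (chartAt E s₀) T)
    (by simpa using eventually_symm_mem_lineBase ha ha')
  exact this.mono fun t ht => hν ▸ lineDir_mem_puncturedCone ht.2

/-- Any local lift `g` equals `t(g) • n`. If `dn` kills `u`, then `dg u` is a multiple of `n`, which
the immersion condition on the lift excludes unless `u = 0`. -/
theorem injective_fderiv_lineDir (ha : a ∈ (chartAt E s₀).target)
    (ha' : (chartAt E s₀).symm a ∈ lineBase S (chartAt E s₀) T) :
    Function.Injective (fderiv ℂ (lineDir S (chartAt E s₀) T) a) := by
  set φ := chartAt E s₀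
  have : IsManifold 𝓘(ℂ, E) 1 S := IsManifold.of_le (n := ω) le_top
  have hφ := mdifferentiable_chart (I := 𝓘(ℂ, E)) s₀
  obtain ⟨f, hf, hf', himm⟩ := IsComplexSubmanifold.exists_lift (E := E) (φ.symm a)
  have hfd : MDifferentiableAt 𝓘(ℂ, E) 𝓘(ℂ, W) f (φ.symm a) := hf.mdifferentiableAt (by simp)
  have hsd : MDifferentiableAt 𝓘(ℂ, E) 𝓘(ℂ, E) φ.symm a := hφ.symm.mdifferentiableAt ha
  set g : E → W := f ∘ φ.symm
  have hcomp : fderiv ℂ g a = (mfderiv 𝓘(ℂ, E) 𝓘(ℂ, W) f (φ.symm a)).comp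
      (mfderiv 𝓘(ℂ, E) 𝓘(ℂ, E) φ.symm a) := by
    rw [← mfderiv_eq_fderiv]
    exact mfderiv_comp a hfd hsd
  have hgd : DifferentiableAt ℂ g a := mdifferentiableAt_iff_differentiableAt.1 (hfd.comp a hsd)
  have hnd := (contDiffAt_lineDir ha ha').differentiableAt (by simp)
  have hkd : HasFDerivAt (fun x => hypForm T (g x)) (hypForm T ∘L fderiv ℂ g a) a :=
    (hypForm T).hasFDerivAt.comp a hgd.hasFDerivAt
  have heq : g =ᶠ[𝓝 a] fun x => hypForm T (g x) • lineDir S φ T x := by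
    have h1 : ∀ᶠ x in 𝓝 a, f (φ.symm x) ≠ 0 ∧
        f (φ.symm x) ∈ ((φ.symm x : S) : ℙ ℂ W).submodule :=
      (φ.symm.continuousAt ha).eventually hf'
    filter_upwards [h1, eventually_symm_mem_lineBase ha ha'] with x hx hx'
    exact eq_smul_normRep T _ hx'.2.2 _ hx.2
  have hg := ((hkd.smul hnd.hasFDerivAt).congr_of_eventuallyEq heq).fderiv
  rw [injective_iff_map_eq_zero]
  intro u hu
  have hgu : fderiv ℂ g a u = hypForm T (fderiv ℂ g a u) • lineDir S φ T a := by
    have h := congrArg (fun L : E →L[ℂ] W => L u) hg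
    simp only [_root_.add_apply, _root_.smul_apply] at h
    rw [hu, smul_zero, zero_add] at h
    exact h
  have hmem : fderiv ℂ g a u ∈ ((φ.symm a : S) : ℙ ℂ W).submodule := by
    rw [hgu]
    exact Submodule.smul_mem _ _ (normRep_mem T _)
  rw [hcomp] at hmem
  have h0 := himm (mfderiv 𝓘(ℂ, E) 𝓘(ℂ, E) φ.symm a u) hmem
  exact (injective_iff_map_eq_zero _).1 (hφ.symm.mfderiv_injective ha) u h0

end

/-- The map `lineCoord` in terms of the coordinates on `S`. -/
def lineMap (T : W ≃L[ℂ] ℂ × HypModel W) (n : E → W) (x : E × (W × I)) : E × (HypModel W × I) :=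
  (x.1, (T (Ω.mul x.2 (-(T x.2.1).1 • n x.1, 0)).1).2, (Ω.mul x.2 (-(T x.2.1).1 • n x.1, 0)).2)

theorem lineCoord_eq_lineMap (φ : OpenPartialHomeomorph S E) {q : S × (W × I)}
    (hq : q.1 ∈ φ.source) :
    lineCoord Ω S φ T q = lineMap Ω T (lineDir S φ T) (φ q.1, q.2) := by
  simp only [lineCoord, lineMap, lineDir, φ.left_inv hq]

theorem exists_hasFDerivAt_lineMap {n : E → W} {x : E × (W × I)} (hn : DifferentiableAt ℂ n x.1) :
    ∃ G : E × (W × I) →L[ℂ] E × (HypModel W × I), HasFDerivAt (lineMap Ω T n) G x ∧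
      ∀ v, G v = (v.1,
        hypProj T (v.2.1 - hypForm T v.2.1 • n x.1 - hypForm T x.2.1 • fderiv ℂ n x.1 v.1),
        v.2.2 - (1 / 2 : ℂ) • (hypForm T v.2.1 • Ω.form x.2.1 (n x.1) +
          hypForm T x.2.1 • Ω.form v.2.1 (n x.1) +
          hypForm T x.2.1 • Ω.form x.2.1 (fderiv ℂ n x.1 v.1))) := by
  have h1 : HasFDerivAt (fun x : E × (W × I) => x.1) (ContinuousLinearMap.fst ℂ E (W × I)) x :=
    hasFDerivAt_fst
  have h2 : HasFDerivAt (fun x : E × (W × I) => x.2.1) (ContinuousLinearMap.fst ℂ W I ∘L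
    ContinuousLinearMap.snd ℂ E (W × I)) x := hasFDerivAt_fst.comp x hasFDerivAt_snd
  have h3 : HasFDerivAt (fun x : E × (W × I) => x.2.2) (ContinuousLinearMap.snd ℂ W I ∘L
    ContinuousLinearMap.snd ℂ E (W × I)) x := hasFDerivAt_snd.comp x hasFDerivAt_snd
  have h4 : HasFDerivAt (fun x : E × (W × I) => -hypForm T x.2.1) _ x :=
    ((hypForm T).hasFDerivAt.comp x h2).neg
  have h5 : HasFDerivAt (fun x : E × (W × I) => n x.1) _ x := hn.hasFDerivAt.comp x h1
  have h6 := h4.smul h5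
  have h7 : HasFDerivAt (fun x : E × (W × I) =>
      hypProj T (x.2.1 + (-hypForm T x.2.1) • n x.1)) _ x :=
    (hypProj T).hasFDerivAt.comp x (h2.add h6)
  have h8 : HasFDerivAt (fun x : E × (W × I) =>
      x.2.2 + 0 + (1 / 2 : ℂ) • Ω.form x.2.1 ((-hypForm T x.2.1) • n x.1)) _ x :=
    (h3.add_const 0).add ((Ω.form.hasFDerivAt_of_bilinear h2 h6).const_smul (1 / 2 : ℂ))
  refine ⟨_, h1.prodMk (h7.prodMk h8), fun v => ?_⟩
  refine Prod.ext rfl (Prod.ext ?_ ?_)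
  · simp
    abel
  · simp
    module

end LineCharts

/-! ### Descent of the distribution to the space of lines -/

section LineDistribution

variable {E W I : Type*} [NormedAddCommGroup E] [NormedSpace ℂ E]
  [NormedAddCommGroup W] [NormedSpace ℂ W] [FiniteDimensional ℂ W]
  [NormedAddCommGroup I] [NormedSpace ℂ I]
variable {Ω : SymplecticForm W I} {S : Set (ℙ ℂ W)} [ChartedSpace E S] [IsComplexSubmanifold E S]
variable {θ₀ : W × I →L[ℂ] ℂ}

theorem mem_distR (hθ₀ : LinearMap.ker θ₀.toLinearMap = Submodule.prod ⊤ ⊥) (p : S × (W × I))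
    (v : E × (W × I)) : v ∈ (distR Ω S θ₀ p : Submodule ℂ (E × (W × I))) ↔
      v.2.2 = (1 / 2 : ℂ) • Ω.form p.2.1 v.2.1 ∧ Ω.form (p.1 : ℙ ℂ W).rep v.2.1 = 0 := by
  have h : mfderiv (𝓘(ℂ, E).prod 𝓘(ℂ, W × I)) 𝓘(ℂ, W × I) (Prod.snd : S × (W × I) → W × I) p v
      = v.2 := by
    rw [mfderiv_snd]
    rfl
  have h' : v ∈ (distR Ω S θ₀ p : Submodule ℂ (E × (W × I))) ↔
      v.2 ∈ Ω.leftW p.2 ∧ extDerivOne (Ω.leftForm θ₀) p.2 v.2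
        (Ω.leftDeriv p.2 ((p.1 : ℙ ℂ W).rep, 0)) = 0 := by
    rw [← h]
    rfl
  rw [h', Ω.mem_leftW, extDerivOne_leftForm Ω hθ₀, neg_eq_zero, centralForm_eq_zero hθ₀,
    Ω.leftDeriv_apply, Ω.form_swap (p.1 : ℙ ℂ W).rep, neg_eq_zero]

/-- The linear coordinates of `W` used in the chart around `ℓ₀`. -/
def lineAffine (ℓ₀ : SLine Ω S) : W ≃L[ℂ] ℂ × HypModel W :=
  (exists_affineSet (SLine.dir Ω S ℓ₀ : ℙ ℂ W)).choose

variable (E) in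
/-- The direction vector in the chart around `ℓ₀`. -/
def lineChartDir (ℓ₀ : SLine Ω S) : E → W :=
  lineDir S (chartAt E (SLine.dir Ω S ℓ₀)) (lineAffine ℓ₀)

variable (E) in
/-- The common kernels of the central and the direction 1-form in the chart around `ℓ₀`. -/
def lineModel (l : I →L[ℂ] ℂ) (ℓ₀ : SLine Ω S) :
    E × (HypModel W × I) → Submodule ℂ (E × (HypModel W × I)) :=
  coframeKer (centralCoform (lineAffine ℓ₀) (Ω.scalar l) l)
    (directionCoform (lineAffine ℓ₀) (Ω.scalar l) (lineChartDir E ℓ₀))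

/-- The differential of the projection in a chart, with the two facts that descent needs: it is
onto, and it pulls `lineModel` back to `distR`. Both conditions of `distR` are matched using `Ω N N
= 0` and the Legendrian identity `Ω N (D a) = 0`. -/
theorem exists_hasMFDerivAt_chart_proj (hS : IsLegendrian Ω S)
    (hθ₀ : LinearMap.ker θ₀.toLinearMap = Submodule.prod ⊤ ⊥)
    (ℓ₀ : SLine Ω S) (p : S × (W × I))
    (hp : SLine.proj Ω S p ∈ (chartAt (E × (HypModel W × I)) ℓ₀).source) :
    ∃ L : E × (W × I) →L[ℂ] E × (HypModel W × I),
      HasMFDerivAt (𝓘(ℂ, E).prod 𝓘(ℂ, W × I)) 𝓘(ℂ, E × (HypModel W × I))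
        (fun q => chartAt (E × (HypModel W × I)) ℓ₀ (SLine.proj Ω S q)) p L ∧
      Function.Surjective L ∧
      ∀ v : E × (W × I), v ∈ (distR Ω S θ₀ p : Submodule ℂ (E × (W × I))) ↔
        L v ∈ lineModel E (centralForm θ₀) ℓ₀
          (chartAt (E × (HypModel W × I)) ℓ₀ (SLine.proj Ω S p)) := by
  set T := lineAffine ℓ₀ with hT
  set s₀ := SLine.dir Ω S ℓ₀ with hs₀
  set φ := chartAt E s₀ with hφ
  have hp' : p.1 ∈ lineBase S φ T := hp
  have hev : ∀ᶠ q in 𝓝 p, chartAt (E × (HypModel W × I)) ℓ₀ (SLine.proj Ω S q) =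
      lineMap Ω T (lineDir S φ T) (φ q.1, q.2) := by
    have : ∀ᶠ q : S × (W × I) in 𝓝 p, q.1 ∈ lineBase S φ T :=
      ((isOpen_lineBase S _ T).preimage continuous_fst).mem_nhds hp'
    filter_upwards [this] with q hq
    rw [← lineCoord_eq_lineMap Ω φ hq.1]
    exact lineCoord_out Ω S φ T q hq.2
  have hφa : φ p.1 ∈ φ.target := φ.map_source hp'.1
  have hφs : φ.symm (φ p.1) = p.1 := φ.left_inv hp'.1
  have hφa' : φ.symm (φ p.1) ∈ lineBase S φ T := by rwa [hφs]
  have hn := (contDiffAt_lineDir hφa hφa').differentiableAt (by simp)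
  have hnval : lineDir S φ T (φ p.1) = normRep T (p.1 : ℙ ℂ W) := by rw [lineDir, hφs]
  have htn := hypForm_lineDir hφa'
  have htD := hypForm_fderiv_lineDir hφa hφa'
  have hND := form_lineDir_fderiv Ω hS hφa hφa'
  obtain ⟨G, hG, hGv⟩ := exists_hasFDerivAt_lineMap Ω (T := T) (x := (φ p.1, p.2)) hn
  simp only at hGv
  set N := lineDir S φ T (φ p.1)
  set D := fderiv ℂ (lineDir S φ T) (φ p.1)
  set A := chartDeriv (E := E) hp'.1
  have hφd : HasMFDerivAt 𝓘(ℂ, E) 𝓘(ℂ, E) φ p.1 (A : TangentSpace 𝓘(ℂ, E) p.1 →L[ℂ] E) := by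
    have : IsManifold 𝓘(ℂ, E) 1 S := IsManifold.of_le (n := ω) le_top
    exact ((mdifferentiable_chart (I := 𝓘(ℂ, E)) s₀).mdifferentiableAt hp'.1).hasMFDerivAt
  have h1 : HasMFDerivAt (𝓘(ℂ, E).prod 𝓘(ℂ, W × I)) 𝓘(ℂ, E)
      (fun q : S × (W × I) => φ q.1) p _ := hφd.comp p (hasMFDerivAt_fst p)
  have h2 : HasMFDerivAt (𝓘(ℂ, E).prod 𝓘(ℂ, W × I)) 𝓘(ℂ, W × I)
      (fun q : S × (W × I) => q.2) p _ := hasMFDerivAt_snd p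
  set A' : E × (W × I) →L[ℂ] E × (W × I) :=
    ((A : TangentSpace 𝓘(ℂ, E) p.1 →L[ℂ] E) ∘L ContinuousLinearMap.fst ℂ E (W × I)).prod
      (ContinuousLinearMap.snd ℂ E (W × I)) with hA'
  have h3 : HasMFDerivAt (𝓘(ℂ, E).prod 𝓘(ℂ, W × I)) 𝓘(ℂ, E × (W × I))
      (fun q : S × (W × I) => (φ q.1, q.2)) p A' :=
    ⟨h1.1.prodMk h2.1, h1.2.prodMk h2.2⟩
  have h4 : HasMFDerivAt 𝓘(ℂ, E × (W × I)) 𝓘(ℂ, E × (HypModel W × I))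
      (lineMap Ω T (lineDir S φ T)) (φ p.1, p.2) G := hG.hasMFDerivAt
  have hev' : (fun q => chartAt (E × (HypModel W × I)) ℓ₀ (SLine.proj Ω S q)) =ᶠ[𝓝 p]
      lineMap Ω T (lineDir S φ T) ∘ fun q : S × (W × I) => (φ q.1, q.2) := hev
  have h5 : HasMFDerivAt (𝓘(ℂ, E).prod 𝓘(ℂ, W × I)) 𝓘(ℂ, E × (HypModel W × I))
      (fun q => chartAt (E × (HypModel W × I)) ℓ₀ (SLine.proj Ω S q)) p (G ∘L A') :=
    (HasMFDerivAt.comp p h4 h3 :).congr_of_eventuallyEq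
      (f₁ := fun q => chartAt (E × (HypModel W × I)) ℓ₀ (SLine.proj Ω S q)) hev'
  have hval : chartAt (E × (HypModel W × I)) ℓ₀ (SLine.proj Ω S p) =
      lineMap Ω T (lineDir S φ T) (φ p.1, p.2) := hev.self_of_nhds
  refine ⟨G ∘L A', h5, ?_, ?_⟩
  · rintro ⟨a, h, z⟩
    -- The added term cancels the shift by `D a` in the hyperplane component of `G`. Since `t u =
    -- 0`, the terms of `G` with factor `t u` drop out.
    set u : W := hypIncl T h + hypForm T p.2.1 • D a with hu
    have htu : hypForm T u = 0 := by simp [hu, D, htD]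
    refine ⟨(A.symm a, u, z + (1 / 2 : ℂ) • (hypForm T p.2.1 • Ω.form u N +
      hypForm T p.2.1 • Ω.form p.2.1 (D a))), ?_⟩
    have hA0 : A' (A.symm a, u, z + (1 / 2 : ℂ) • (hypForm T p.2.1 • Ω.form u N +
      hypForm T p.2.1 • Ω.form p.2.1 (D a))) = (a, u, z + (1 / 2 : ℂ) •
        (hypForm T p.2.1 • Ω.form u N + hypForm T p.2.1 • Ω.form p.2.1 (D a))) :=
      Prod.ext (A.apply_symm_apply a) rfl
    rw [ContinuousLinearMap.comp_apply, hA0, hGv]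
    simp only [htu, zero_smul, sub_zero, zero_add]
    simp [hu]
  · rintro ⟨b, u, z⟩
    have hA0 : A' (b, u, z) = (A b, u, z) := rfl
    rw [mem_distR hθ₀, hval, lineModel, mem_coframeKer, centralCoform_apply, directionCoform_apply,
      ContinuousLinearMap.comp_apply, hA0, hGv]
    simp only
    generalize A b = a
    have hrep : Ω.form (p.1 : ℙ ℂ W).rep u = 0 ↔ Ω.form N u = 0 := by
      have : (T (p.1 : ℙ ℂ W).rep).1 ≠ 0 := hp'.2
      simp only [N, hnval, normRep, map_smul, _root_.smul_apply, smul_eq_zero, inv_eq_zero, this,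
        false_or]
    have hw : hypIncl T (hypProj T (u - hypForm T u • N - hypForm T p.2.1 • D a)) =
        u - hypForm T u • N - hypForm T p.2.1 • D a :=
      hypIncl_hypProj T (by simp [N, D, htn, htD])
    have hx : hypIncl T (lineMap Ω T (lineDir S φ T) (φ p.1, p.2)).2.1 =
        p.2.1 - hypForm T p.2.1 • N := by
      change hypIncl T (hypProj T (p.2.1 + (-hypForm T p.2.1) • N)) = _
      rw [hypIncl_hypProj T (by simp [N, htn])]
      module
    have hdir : lineChartDir E ℓ₀ (lineMap Ω T (lineDir S φ T) (φ p.1, p.2)).1 = N := rfl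
    rw [← hT, hw, hx, hdir, hrep]
    have hswap : Ω.form N p.2.1 = -Ω.form p.2.1 N := Ω.form_swap _ _
    have hswap' : Ω.form u N = -Ω.form N u := Ω.form_swap _ _
    have e2 : Ω.scalar (centralForm θ₀) N (u - hypForm T u • N - hypForm T p.2.1 • D a) =
        centralForm θ₀ (Ω.form N u) := by
      simp [Ω.alternating, N, D, hND]
    rw [e2, centralForm_eq_zero hθ₀]
    -- The contact conditions agree only modulo `Ω N u = 0`, so this equation is available when
    -- comparing them.
    refine and_congr_left fun hNu => ?_
    rw [hNu, neg_zero] at hswap'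
    have e1 : Ω.form (p.2.1 - hypForm T p.2.1 • N) (u - hypForm T u • N - hypForm T p.2.1 • D a) =
        Ω.form p.2.1 u - hypForm T u • Ω.form p.2.1 N - hypForm T p.2.1 • Ω.form p.2.1 (D a) := by
      simp only [map_sub, map_smul, _root_.sub_apply, _root_.smul_apply, hNu, Ω.alternating,
        smul_zero, sub_zero]
      have : Ω.form N (D a) = 0 := hND a
      rw [this]
      simp
    have e3 (b c : I) : centralForm θ₀ b - 1 / 2 * centralForm θ₀ c =
        centralForm θ₀ (b - (1 / 2 : ℂ) • c) := by simp
    rw [Ω.scalar_apply, e1, hswap', e3, centralForm_eq_zero hθ₀, ← sub_eq_zero]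
    refine Eq.congr ?_ rfl
    module

theorem exists_proj_eq (ℓ : SLine Ω S) : ∃ p, SLine.proj Ω S p = ℓ := Quotient.exists_rep ℓ

theorem mdifferentiableAt_proj (p : S × (W × I)) :
    MDifferentiableAt (𝓘(ℂ, E).prod 𝓘(ℂ, W × I)) 𝓘(ℂ, E × (HypModel W × I))
      (SLine.proj Ω S) p :=
  (contMDiff_proj Ω S p).mdifferentiableAt (by simp)

theorem mfderiv_chart_proj (ℓ₀ : SLine Ω S) (p : S × (W × I))
    (hp : SLine.proj Ω S p ∈ (chartAt (E × (HypModel W × I)) ℓ₀).source)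
    {L : E × (W × I) →L[ℂ] E × (HypModel W × I)}
    (hL : HasMFDerivAt (𝓘(ℂ, E).prod 𝓘(ℂ, W × I)) 𝓘(ℂ, E × (HypModel W × I))
        (fun q => chartAt (E × (HypModel W × I)) ℓ₀ (SLine.proj Ω S q)) p L) (v : E × (W × I)) :
    L v = chartDeriv hp (mfderiv (𝓘(ℂ, E).prod 𝓘(ℂ, W × I)) 𝓘(ℂ, E × (HypModel W × I))
      (SLine.proj Ω S) p v) := by
  have : IsManifold 𝓘(ℂ, E × (HypModel W × I)) 1 (SLine Ω S) := IsManifold.of_le (n := ω) le_top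
  have hc : HasMFDerivAt 𝓘(ℂ, E × (HypModel W × I)) 𝓘(ℂ, E × (HypModel W × I))
      (chartAt (E × (HypModel W × I)) ℓ₀) (SLine.proj Ω S p)
      (chartDeriv hp : TangentSpace 𝓘(ℂ, E × (HypModel W × I)) (SLine.proj Ω S p) →L[ℂ]
        E × (HypModel W × I)) :=
    ((mdifferentiable_chart (I := 𝓘(ℂ, E × (HypModel W × I))) ℓ₀).mdifferentiableAt hp).hasMFDerivAt
  have := hasMFDerivAt_unique hL (hc.comp p (mdifferentiableAt_proj p).hasMFDerivAt)
  exact congrArg (fun L : E × (W × I) →L[ℂ] E × (HypModel W × I) => L v) this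

theorem mem_distR_iff_mem_lineModel (hS : IsLegendrian Ω S)
    (hθ₀ : LinearMap.ker θ₀.toLinearMap = Submodule.prod ⊤ ⊥)
    (ℓ₀ : SLine Ω S) (p : S × (W × I))
    (hp : SLine.proj Ω S p ∈ (chartAt (E × (HypModel W × I)) ℓ₀).source)
    (v : TangentSpace (𝓘(ℂ, E).prod 𝓘(ℂ, W × I)) p) :
    v ∈ distR Ω S θ₀ p ↔ chartDeriv hp (mfderiv (𝓘(ℂ, E).prod 𝓘(ℂ, W × I))
      𝓘(ℂ, E × (HypModel W × I)) (SLine.proj Ω S) p v) ∈ lineModel E (centralForm θ₀) ℓ₀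
          (chartAt (E × (HypModel W × I)) ℓ₀ (SLine.proj Ω S p)) := by
  obtain ⟨L, hL, -, h⟩ := exists_hasMFDerivAt_chart_proj hS hθ₀ ℓ₀ p hp
  exact (h v).trans (iff_of_eq (congrArg (· ∈ lineModel E (centralForm θ₀) ℓ₀ _)
    (mfderiv_chart_proj ℓ₀ p hp hL v)))

theorem surjective_mfderiv_proj (hS : IsLegendrian Ω S)
    (hθ₀ : LinearMap.ker θ₀.toLinearMap = Submodule.prod ⊤ ⊥) (p : S × (W × I)) :
    Function.Surjective (mfderiv (𝓘(ℂ, E).prod 𝓘(ℂ, W × I))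
      𝓘(ℂ, E × (HypModel W × I)) (SLine.proj Ω S) p) := by
  have hp := mem_chart_source (E × (HypModel W × I)) (SLine.proj Ω S p)
  obtain ⟨L, hL, hsurj, -⟩ := exists_hasMFDerivAt_chart_proj hS hθ₀ _ p hp
  intro w
  obtain ⟨v, hv⟩ := hsurj (chartDeriv hp w)
  rw [mfderiv_chart_proj _ p hp hL] at hv
  exact ⟨v, (chartDeriv hp).injective hv⟩

variable (E Ω S) in
/-- The distribution on the space of lines whose inverse image is `distR`. -/
def lineDistribution (l : I →L[ℂ] ℂ) (ℓ : SLine Ω S) :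
    Submodule ℂ (TangentSpace 𝓘(ℂ, E × (HypModel W × I)) ℓ) :=
  (lineModel E l ℓ (chartAt (E × (HypModel W × I)) ℓ ℓ)).comap
    (mfderiv 𝓘(ℂ, E × (HypModel W × I)) 𝓘(ℂ, E × (HypModel W × I))
      (chartAt (E × (HypModel W × I)) ℓ) ℓ).toLinearMap

theorem isInverseImage_lineDistribution (hS : IsLegendrian Ω S)
    (hθ₀ : LinearMap.ker θ₀.toLinearMap = Submodule.prod ⊤ ⊥) :
    IsInverseImage Ω S (distR Ω S θ₀) (lineDistribution E Ω S (centralForm θ₀)) := by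
  intro p
  ext v
  exact mem_distR_iff_mem_lineModel hS hθ₀ _ p (mem_chart_source _ _) v

/-- Taking preimages under a surjective linear map is injective on subspaces, so `distR` determines
`Q`. -/
theorem isChartExpression_of_isInverseImage (hS : IsLegendrian Ω S)
    (hθ₀ : LinearMap.ker θ₀.toLinearMap = Submodule.prod ⊤ ⊥)
    {Q : ∀ ℓ : SLine Ω S, Submodule ℂ (TangentSpace 𝓘(ℂ, E × (HypModel W × I)) ℓ)}
    (hQ : IsInverseImage Ω S (distR Ω S θ₀) Q) (ℓ₀ : SLine Ω S) :
    IsChartExpression Q ℓ₀ (lineModel E (centralForm θ₀) ℓ₀) := by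
  intro ℓ hℓ
  obtain ⟨p, rfl⟩ := exists_proj_eq ℓ
  refine Submodule.comap_injective_of_surjective (surjective_mfderiv_proj hS hθ₀ p) ?_
  change Submodule.comap (mfderiv (𝓘(ℂ, E).prod 𝓘(ℂ, W × I))
      𝓘(ℂ, E × (HypModel W × I)) (SLine.proj Ω S) p).toLinearMap _ = _
  rw [← hQ p]
  ext v
  exact mem_distR_iff_mem_lineModel hS hθ₀ ℓ₀ p hℓ v

end LineDistribution

/-! ### The null space over the space of lines -/

section LegendrianLines

variable {E W I : Type*} [NormedAddCommGroup E] [NormedSpace ℂ E]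
  [NormedAddCommGroup W] [NormedSpace ℂ W] [FiniteDimensional ℂ W]
  [NormedAddCommGroup I] [NormedSpace ℂ I]
variable {Ω : SymplecticForm W I} {S : Set (ℙ ℂ W)} [ChartedSpace E S] [IsComplexSubmanifold E S]
variable {θ₀ : W × I →L[ℂ] ℂ}

theorem bijective_centralForm (hI : Module.finrank ℂ I = 1)
    (hθ₀ : LinearMap.ker θ₀.toLinearMap = Submodule.prod ⊤ ⊥) :
    Function.Bijective (centralForm θ₀) := by
  have : FiniteDimensional ℂ I := Module.finite_of_finrank_pos (by omega)
  have hinj : Function.Injective (centralForm θ₀) :=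
    (injective_iff_map_eq_zero _).2 fun z => (centralForm_eq_zero hθ₀).1
  exact ⟨hinj, (LinearMap.injective_iff_surjective_of_finrank_eq_finrank
    (f := (centralForm θ₀).toLinearMap) (by rw [hI, Module.finrank_self])).1 hinj⟩

theorem SymplecticForm.scalar_self (l : I →L[ℂ] ℂ) (w : W) : Ω.scalar l w w = 0 := by
  simp [Ω.alternating]

theorem SymplecticForm.eq_zero_of_scalar {l : I →L[ℂ] ℂ} (hl : Function.Injective l) (w : W)
    (h : ∀ w', Ω.scalar l w w' = 0) : w = 0 :=
  Ω.nondegenerate w fun w' => (injective_iff_map_eq_zero l).1 hl _ (h w')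

/-- Since `W = ℂ N ⊕ ker t` and `B N N = 0`, a pairing with `N` vanishing on `ker t` would vanish on
all of `W`. -/
theorem exists_scalar_hypIncl_ne_zero {l : I →L[ℂ] ℂ} (hl : Function.Injective l)
    {T : W ≃L[ℂ] ℂ × HypModel W} {N : W} (hN : hypForm T N = 1) :
    ∃ h, Ω.scalar l N (hypIncl T h) ≠ 0 := by
  by_contra! h
  have : N = 0 := Ω.eq_zero_of_scalar hl N fun w => by
    have := h (hypProj T (w - hypForm T w • N))
    rw [hypIncl_hypProj T (by simp [hN])] at this
    simpa [Ω.alternating] using this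
  simp [this] at hN

theorem lineModel_coframe {l : I →L[ℂ] ℂ} (hl : Function.Bijective l) (ℓ₀ : SLine Ω S) :
    ∃ e₁ : E × (HypModel W × I), ∀ y ∈ (chartAt (E × (HypModel W × I)) ℓ₀).target,
      AnalyticAt ℂ (centralCoform (lineAffine ℓ₀) (Ω.scalar l) l) y ∧
      AnalyticAt ℂ (directionCoform (lineAffine ℓ₀) (Ω.scalar l) (lineChartDir E ℓ₀)) y ∧
      centralCoform (lineAffine ℓ₀) (Ω.scalar l) l y e₁ = 1 ∧
      directionCoform (lineAffine ℓ₀) (Ω.scalar l) (lineChartDir E ℓ₀) y e₁ = 0 ∧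
      ∃ e₂, directionCoform (lineAffine ℓ₀) (Ω.scalar l) (lineChartDir E ℓ₀) y e₂ ≠ 0 := by
  obtain ⟨z, hz⟩ := hl.2 1
  -- The central direction with `l z = 1` is dual to the first form at every point; the vector
  -- detecting the second form depends on `y`.
  refine ⟨(0, 0, z), fun y hy => ?_⟩
  obtain ⟨hy₁, hy₂⟩ : y.1 ∈ (chartAt E (SLine.dir Ω S ℓ₀)).target ∩
    (chartAt E (SLine.dir Ω S ℓ₀)).symm ⁻¹' lineBase S _ (lineAffine ℓ₀) := hy
  obtain ⟨h, hh⟩ := exists_scalar_hypIncl_ne_zero (Ω := Ω) hl.1 (hypForm_lineDir hy₂)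
  exact ⟨analyticAt_centralCoform y,
    analyticAt_directionCoform (contDiffAt_lineDir hy₁ hy₂).analyticAt,
    by simp [centralCoform_apply, hz], by simp [directionCoform_apply], (0, h, 0), hh⟩

theorem isDistributionOfCorank_lineDistribution [FiniteDimensional ℂ E]
    (hE : 0 < Module.finrank ℂ E) (hI : Module.finrank ℂ I = 1) (hS : IsLegendrian Ω S)
    (hθ₀ : LinearMap.ker θ₀.toLinearMap = Submodule.prod ⊤ ⊥) :
    IsDistributionOfCorank 2 (lineDistribution E Ω S (centralForm θ₀)) := by
  have : FiniteDimensional ℂ I := Module.finite_of_finrank_pos (by omega)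
  refine isDistributionOfCorank_of_isChartExpression ?_ fun ℓ₀ => ?_
  · rw [Module.finrank_prod, Module.finrank_prod, hI]
    omega
  · obtain ⟨e₁, he₁⟩ := lineModel_coframe (E := E) (bijective_centralForm hI hθ₀) ℓ₀
    obtain ⟨-, -, -, -, e₂, he₂⟩ := he₁ _
      ((chartAt (E × (HypModel W × I)) ℓ₀).map_source (mem_chart_source _ ℓ₀))
    exact ⟨_, _, e₁, e₂, isChartExpression_of_isInverseImage hS hθ₀
      (isInverseImage_lineDistribution hS hθ₀) ℓ₀,
      fun y hy => ⟨(he₁ y hy).1, (he₁ y hy).2.1, (he₁ y hy).2.2.1, (he₁ y hy).2.2.2.1⟩, he₂⟩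

theorem finrank_twistedNull_line [FiniteDimensional ℂ E] (hI : Module.finrank ℂ I = 1)
    (hdim : Module.finrank ℂ W = 2 * (Module.finrank ℂ E + 1)) (hS : IsLegendrian Ω S)
    (hθ₀ : LinearMap.ker θ₀.toLinearMap = Submodule.prod ⊤ ⊥)
    {Q : ∀ ℓ : SLine Ω S, Submodule ℂ (TangentSpace 𝓘(ℂ, E × (HypModel W × I)) ℓ)}
    (hQ : IsInverseImage Ω S (distR Ω S θ₀) Q) (ℓ₀ : SLine Ω S) (e : E × (HypModel W × I))
    {q : ProjCotangent (E × (HypModel W × I)) (SLine Ω S)} (hq : q ∈ affineDomain ℓ₀ e)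
    (hqQ : q ∈ projAnnihilator Q) :
    Module.finrank ℂ (twistedNull Q ℓ₀ e q) = Module.finrank ℂ E := by
  have hl := bijective_centralForm hI hθ₀
  have hchart := isChartExpression_of_isInverseImage hS hθ₀ hQ ℓ₀
  rw [twistedNull_eq_formNull hchart]
  have hmem : affineCoord ℓ₀ e q ∈ annihilatorSlice (chartAt (E × (HypModel W × I)) ℓ₀).target
      (lineModel E (centralForm θ₀) ℓ₀) e := by
    rw [← affineCoord_image_projAnnihilator hchart]
    exact ⟨q, ⟨hqQ, hq⟩, rfl⟩
  generalize affineCoord ℓ₀ e q = x at hmem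
  obtain ⟨y, ξ⟩ := x
  obtain ⟨hy, hξ, hξe⟩ := hmem
  simp only at hy hξ hξe
  obtain ⟨e₁, he₁⟩ := lineModel_coframe (E := E) hl ℓ₀
  obtain ⟨hα₁, hα₂, h₁, h₂, e₂, h₃⟩ := he₁ y hy
  have hcomb := eq_combination_of_ker_le h₁ h₂ h₃ fun v hv hv' => hξ v ⟨hv, hv'⟩
  generalize ξ e₁ = p at hcomb
  generalize (ξ e₂ - p * centralCoform (lineAffine ℓ₀) (Ω.scalar (centralForm θ₀)) (centralForm θ₀)
    y e₂) / directionCoform (lineAffine ℓ₀) (Ω.scalar (centralForm θ₀)) (lineChartDir E ℓ₀) y e₂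
      = r at hcomb
  -- The normalization `ξ e = 1` excludes the zero covector.
  have hpq : p ≠ 0 ∨ r ≠ 0 := by
    by_contra! h
    rw [hcomb, h.1, h.2] at hξe
    simp at hξe
  obtain ⟨hy₁, hy₂⟩ : y.1 ∈ (chartAt E (SLine.dir Ω S ℓ₀)).target ∩
    (chartAt E (SLine.dir Ω S ℓ₀)).symm ⁻¹' lineBase S _ (lineAffine ℓ₀) := id hy
  have hn := contDiffAt_lineDir hy₁ hy₂
  have hND (a : E) (ha : a ∈ (chartAt E (SLine.dir Ω S ℓ₀)).target)
      (ha' : (chartAt E (SLine.dir Ω S ℓ₀)).symm a ∈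
        lineBase S (chartAt E (SLine.dir Ω S ℓ₀)) (lineAffine ℓ₀)) (u : E) :
      Ω.scalar (centralForm θ₀) (lineChartDir E ℓ₀ a) (fderiv ℂ (lineChartDir E ℓ₀) a u) = 0 := by
    rw [Ω.scalar_apply, centralForm_eq_zero hθ₀]
    exact form_lineDir_fderiv Ω hS ha ha' u
  rw [lineModel, finrank_formNull_annihilatorSlice (chartAt _ ℓ₀).open_target hy
    (fun x hx => (he₁ x hx).2.2.1) (fun x hx => (he₁ x hx).2.2.2.1) h₃ hα₁ hα₂ hcomb hξe]
  exact finrank_skewNull_lineModel (Ω.scalar_self _) (Ω.eq_zero_of_scalar hl.1) hdim hl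
    (hn.differentiableAt (by simp)) (hypForm_lineDir hy₂) (hypForm_fderiv_lineDir hy₁ hy₂)
    (injective_fderiv_lineDir hy₁ hy₂) (hND _ hy₁ hy₂)
    (isotropic_fderiv (apply_eq_neg_of_alternating (Ω.scalar_self _)) hn
      ((eventually_symm_mem_lineBase hy₁ hy₂).mono fun x hx => hND x hx.1 hx.2)) hpq

end LegendrianLines

end

theorem corollary4p8
    {W I : Type*} [NormedAddCommGroup W] [NormedSpace ℂ W] [FiniteDimensional ℂ W]
    [NormedAddCommGroup I] [NormedSpace ℂ I]
    (m : ℕ) (hm : 2 ≤ m) (hW : Module.finrank ℂ W = 2 * m) (hI : Module.finrank ℂ I = 1)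
    (Ω : SymplecticForm W I)
    (θ₀ : W × I →L[ℂ] ℂ) (hθ₀ : LinearMap.ker θ₀.toLinearMap = Submodule.prod ⊤ ⊥)
    (S : Set (ℙ ℂ W)) [ChartedSpace (EuclideanSpace ℂ (Fin (m - 1))) S]
    [IsComplexSubmanifold (EuclideanSpace ℂ (Fin (m - 1))) S] (hS : IsLegendrian Ω S) :
    (∃ Q : ∀ ℓ : SLine Ω S, Submodule ℂ (TangentSpace
        𝓘(ℂ, EuclideanSpace ℂ (Fin (m - 1)) × (HypModel W × I)) ℓ),
      IsDistributionOfCorank 2 Q ∧ IsInverseImage Ω S (distR Ω S θ₀) Q) ∧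
    ∀ Q : ∀ ℓ : SLine Ω S, Submodule ℂ (TangentSpace
        𝓘(ℂ, EuclideanSpace ℂ (Fin (m - 1)) × (HypModel W × I)) ℓ),
      IsDistributionOfCorank 2 Q → IsInverseImage Ω S (distR Ω S θ₀) Q →
      ∀ (ℓ : SLine Ω S) (β : TangentSpace
          𝓘(ℂ, EuclideanSpace ℂ (Fin (m - 1)) × (HypModel W × I)) ℓ →L[ℂ] ℂ) (hβ : β ≠ 0),
        (∀ v ∈ Q ℓ, β v = 0) →
        ∀ (ℓ₀ : SLine Ω S) (e : EuclideanSpace ℂ (Fin (m - 1)) × (HypModel W × I)),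
          ProjCotangent.ofCovector ℓ β hβ ∈ affineDomain ℓ₀ e →
          Module.finrank ℂ (twistedNull Q ℓ₀ e (ProjCotangent.ofCovector ℓ β hβ)) = m - 1 := by
  have hdim : Module.finrank ℂ W =
      2 * (Module.finrank ℂ (EuclideanSpace ℂ (Fin (m - 1))) + 1) := by
    rw [finrank_euclideanSpace_fin, hW]
    omega
  refine ⟨⟨lineDistribution _ Ω S (centralForm θ₀), ?_, isInverseImage_lineDistribution hS hθ₀⟩,
    fun Q _ hQ ℓ β hβ hβQ ℓ₀ e he => ?_⟩
  · refine isDistributionOfCorank_lineDistribution ?_ hI hS hθ₀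
    rw [finrank_euclideanSpace_fin]
    omega
  · rw [finrank_twistedNull_line hI hdim hS hθ₀ hQ ℓ₀ e he, finrank_euclideanSpace_fin]
    change ∀ α ∈ (Projectivization.mk ℂ β hβ).submodule, ∀ v ∈ Q ℓ, α v = 0
    intro α hα v hv
    rw [Projectivization.submodule_mk] at hα
    obtain ⟨k, rfl⟩ := Submodule.mem_span_singleton.1 hα
    change k * β v = 0
    rw [hβQ v hv, mul_zero]
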